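/- Let $d\ge 1$, $\Omega=\{1,\dots,d\}^{\{0,1,2,\dots\}}$ with the product topology and the product $\sigma$-algebra $\mathscr F$, and let $\sigma:\Omega\to\Omega$ be the left shift. For $f\in C(\Omega,\mathbb R)$ put $S_nf=\sum_{j=0}^{n-1}f\circ\sigma^j$ and let $f$ be in the Walters class: $$\lim_{p\to\infty}\ \sup_{n\ge1}\ \sup\{|S_nf(x)-S_nf(y)|:\ x_i=y_i \text{ for } 0\le i\le n+p-1\}=0 .$$ Let $L_f\psi(x)=\sum_{\sigma z=x}e^{f(z)}\psi(z)$ on $C(\Omega,\mathbb R)$, and let $L_f^*$ be its dual acting on finite Borel measures, $\int\psi\,dL_f^*\nu=\int L_f\psi\,d\nu$. A normalization of $f$ is a continuous function $\bar f=f+\log\varphi-\log\varphi\circ\sigma-\log\lambda$, where $\varphi\in C(\Omega,\mathbb R)$ is strictly positive, $\lambda>0$ and $L_f\varphi=\lambda\varphi$. An equilibrium state of $f$ is a $\sigma$-invariant Borel probability measure $\mu$ with $h(\mu)+\int f\,d\mu=\sup_{m}\{h(m)+\int f\,dm\}$, the supremum being over all $\sigma$-invariant probability measures $m$, where $h$ is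 the Kolmogorov--Sinai entropy. A family $U=(U_n)_{n\ge0}$ of functions $U_n:\Omega\to\mathbb R$ (with $U_n=-H_n$, $H_n$ the Hamiltonian) determines the probability measures $$K_n^U(\cdot,y)=\frac{\sum_{\sigma^nx=\sigma^ny}e^{U_n(x)}\delta_x}{\sum_{\sigma^nx=\sigma^ny}e^{U_n(x)}} .$$ Let $\mathcal G^{TL}(U)$ be the weak closure of the convex hull of the set of all weak limits of sequences $K^U_{n_k}(\cdot,y_k)$ with $n_k$ strictly increasing and $y_k\in\Omega$. Let $\mathcal G^{DLR}(U)$ be the set of Borel probability measures $\mu$ such that, for all $n$ and all $F\in\mathscr F$, $\mu(F\mid\sigma^{-n}\mathscr F)(y)=K^U_n(F,y)$ for $\mu$-almost every $y$. Let $\mathcal G^*(f)$ be the set of Borel probability measures $\nu$ with $L_f^*\nu=c\,\nu$ for some $c>0$. Write $\mathcal G^{TL}(f)$, $\mathcal G^{DLR}(f)$ and $\mu_n^{y,f}=K_n^U(\cdot,y)$ for $U_n=S_nf$. For a reference configuration $w\in\Omega$ let $\Phi^{f}=\Phi^{f,w}$ be the interaction on the sites $\{0,1,2,\dots\}$ whose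 term on $A=\{k,\dots,2k+n+1\}$, $k,n\ge0$, is $$\Phi^f_A(x)=f(x_k,\dots,x_{2k+n+1},w_{2k+n+2},\dots)-f(x_k,\dots,x_{2k+n},w_{2k+n+1},\dots)\quad(n\ge1),$$ $$\Phi^f_A(x)=f(x_k,\dots,x_{2k+1},w_{2k+2},\dots)-f(w)\quad(n=0),$$ and $\Phi^f_A=0$ for every other finite set $A$. Write $\mathcal G^{TL}(\Phi^f)$ and $\mathcal G^{DLR}(\Phi^f)$ for the sets given by $U_n(x)=\sum_{A\cap\{0,\dots,n-1\}\ne\emptyset}\Phi^f_A(x)$, where the sum means the limit as $N\to\infty$ of the sums over $A\subseteq\{0,\dots,N-1\}$. **Theorem.** Let $f$ be in the Walters class. Then $f$ has exactly one normalization $\bar f$; in any representation of $\bar f$ as above, $\lambda$ is the principal eigenvalue of $L_f$, that is, its spectral radius. Moreover there are Borel probability measures $\mu$ and $\nu$ on $\Omega$ such that the following hold. 1. $\mu$ is the unique equilibrium state of $f$ and the unique equilibrium state of $\bar f$, and for every $y\in\Omega$ the measures $\mu_n^{y,\bar f}=(L_{\bar f}^*)^n\delta_{\sigma^ny}$ converge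 weakly to $\mu$ as $n\to\infty$. 2. $L_f^*\nu=\lambda\nu$, $\nu$ is the unique eigenprobability of $L_f^*$, and for every $y\in\Omega$ the measures $\mu_n^{y,f}=\frac{1}{L_f^n(1)(\sigma^ny)}(L_f^*)^n\delta_{\sigma^ny}$ converge weakly to $\nu$ as $n\to\infty$. 3. For every $w\in\Omega$ the sums defining $U_n$ for $\Phi^{f}$ and $\Phi^{\bar f}$ converge, the set $\mathcal G^{DLR}(\Phi^f)$ is a singleton, and $$\mathcal G^{DLR}(\Phi^f)=\mathcal G^{TL}(\Phi^f)=\mathcal G^{DLR}(f)=\mathcal G^{TL}(f)=\mathcal G^*(f)=\{\nu\};$$ likewise $\mathcal G^{DLR}(\Phi^{\bar f})=\mathcal G^{TL}(\Phi^{\bar f})=\mathcal G^{DLR}(\bar f)=\mathcal G^{TL}(\bar f)=\mathcal G^*(\bar f)=\{\mu\}$. -/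

import Mathlib

open MeasureTheory Filter Topology
open scoped NNReal ENNReal

noncomputable section

namespace WaltersGibbs

/-! ### The full one-sided shift -/

/-- The symbolic space `{1,…,d}^ℕ` with the product topology and product σ-algebra.
Coordinates are numbered from `0`. -/
abbrev Config (d : ℕ) : Type := ℕ → Fin d

variable {d : ℕ}

/-- The left shift `σ`. -/
def shift (x : Config d) : Config d := fun i => x (i + 1)

/-- The word `a` followed by `σⁿ y`, i.e. `(a₀,…,aₙ₋₁,yₙ,yₙ₊₁,…)`. -/
def glue {n : ℕ} (a : Fin n → Fin d) (y : Config d) : Config d :=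
  fun i => if h : i < n then a ⟨i, h⟩ else y i

/-- The point `a x = (a,x₀,x₁,…)`. -/
def cons (a : Fin d) (x : Config d) : Config d
  | 0 => a
  | i + 1 => x i

theorem shift_iterate (n : ℕ) (x : Config d) (i : ℕ) : shift^[n] x i = x (i + n) := by
  induction n generalizing x with
  | zero => rfl
  | succ n ih =>
    rw [Function.iterate_succ_apply, ih]
    exact congrArg x (by omega)

/-- The preimages of `x` under `σ` are the points `a x`. -/
theorem shift_eq_iff (x y : Config d) : shift y = x ↔ ∃ a, y = cons a x := by
  constructor
  · rintro rfl
    refine ⟨y 0, ?_⟩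
    funext i
    cases i <;> rfl
  · rintro ⟨a, rfl⟩
    rfl

theorem cons_injective (x : Config d) : Function.Injective (fun a => cons a x) :=
  fun _ _ h => congrFun h 0

/-- The points `x` with `σⁿ x = σⁿ y` are the points `glue a y`, `a` a word of length `n`. -/
theorem shift_iterate_eq_iff (n : ℕ) (x y : Config d) :
    shift^[n] x = shift^[n] y ↔ ∃ a : Fin n → Fin d, x = glue a y := by
  constructor
  · intro h
    refine ⟨fun i => x i, ?_⟩
    funext i
    by_cases hi : i < n
    · simp [glue, hi]
    · have := congrFun h (i - n)
      rw [shift_iterate, shift_iterate, Nat.sub_add_cancel (not_lt.mp hi)] at this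
      simp [glue, hi, this]
  · rintro ⟨a, rfl⟩
    funext i
    simp [shift_iterate, glue]

theorem glue_injective (n : ℕ) (y : Config d) :
    Function.Injective (fun a : Fin n → Fin d => glue a y) := by
  intro a b h
  funext i
  simpa [glue] using congrFun h (i : ℕ)

theorem continuous_shift : Continuous (shift : Config d → Config d) :=
  continuous_pi fun i => continuous_apply (i + 1)

theorem continuous_cons (a : Fin d) : Continuous (cons a : Config d → Config d) := by
  refine continuous_pi fun i => ?_
  cases i with
  | zero => exact continuous_const
  | succ i => exact continuous_apply i

/-! ### The Walters class -/

/-- The `n`-variation `sup {|g x - g y| : x_i = y_i for 0 ≤ i ≤ n - 1}`, in `[0,∞]`. -/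
def variation (n : ℕ) (g : Config d → ℝ) : ℝ≥0∞ :=
  ⨆ (x : Config d) (y : Config d) (_ : ∀ i < n, x i = y i), ENNReal.ofReal |g x - g y|

/-- `lim_{p → ∞} sup_{n ≥ 1} var_{n+p}(f + f∘σ + ⋯ + f∘σⁿ⁻¹) = 0`. -/
def IsWalters (f : Config d → ℝ) : Prop :=
  Tendsto (fun p : ℕ => ⨆ (n : ℕ) (_ : 1 ≤ n), variation (n + p) (birkhoffSum shift f n))
    atTop (𝓝 0)

/-! ### The Ruelle operator and its dual -/

/-- The continuous map `x ↦ a x`. -/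
def consMap (a : Fin d) : C(Config d, Config d) := ⟨cons a, continuous_cons a⟩

/-- The continuous function `x ↦ exp (f (a x))`. -/
def expCons (f : C(Config d, ℝ)) (a : Fin d) : C(Config d, ℝ) :=
  ⟨fun x => Real.exp (f (cons a x)),
    Real.continuous_exp.comp (f.continuous.comp (continuous_cons a))⟩

/-- The Ruelle operator `L_f ψ (x) = ∑_{σ y = x} exp (f y) ψ y`
as a bounded operator on `C(Ω,ℝ)`. -/
def ruelle (f : C(Config d, ℝ)) : C(Config d, ℝ) →L[ℝ] C(Config d, ℝ) :=
  ∑ a : Fin d, (ContinuousLinearMap.mul ℝ C(Config d, ℝ) (expCons f a)).comp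
    (ContinuousMap.compRightAlgHom ℝ ℝ (consMap a) |>.toLinearMap |>.mkContinuous 1 (by
      intro ψ
      rw [one_mul]
      exact (ContinuousMap.norm_le _ (norm_nonneg _)).2 fun x => ψ.norm_coe_le_norm _))

theorem ruelle_apply (f ψ : C(Config d, ℝ)) (x : Config d) :
    ruelle f ψ x = ∑ a : Fin d, Real.exp (f (cons a x)) * ψ (cons a x) := by
  simp [ruelle, expCons, consMap, ContinuousMap.sum_apply]

/-- The dual Ruelle operator on Borel measures. It is determined on finite measures by
`∫ ψ d(L_f^* ν) = ∫ L_f ψ dν` for all continuous `ψ`, see `integral_ruelleDual`. -/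
def ruelleDual (f : C(Config d, ℝ)) (ν : Measure (Config d)) : Measure (Config d) :=
  ∑ a : Fin d,
    (ν.withDensity fun x => ENNReal.ofReal (Real.exp (f (cons a x)))).map (cons a)

theorem integral_ruelleDual (f ψ : C(Config d, ℝ)) (ν : Measure (Config d))
    [IsFiniteMeasure ν] :
    ∫ x, ψ x ∂(ruelleDual f ν) = ∫ x, ruelle f ψ x ∂ν := by
  have hint : ∀ g : C(Config d, ℝ), Integrable (fun x => g x) ν := fun g =>
    g.continuous.integrable_of_hasCompactSupport
      (HasCompactSupport.of_compactSpace _)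
  have hm : ∀ a : Fin d, Measurable (cons a : Config d → Config d) :=
    fun a => (continuous_cons a).measurable
  have hd : ∀ a : Fin d,
      Measurable fun x : Config d => Real.toNNReal (Real.exp (f (cons a x))) :=
    fun a => (expCons f a).continuous.measurable.real_toNNReal
  have hdens : ∀ a : Fin d,
      (ν.withDensity fun x => ENNReal.ofReal (Real.exp (f (cons a x)))) =
        ν.withDensity fun x => ((Real.toNNReal (Real.exp (f (cons a x))) : ℝ≥0) : ℝ≥0∞) :=
    fun a => rfl
  have key : ∀ a : Fin d, Integrable (fun x => ψ x)
      ((ν.withDensity fun x => ENNReal.ofReal (Real.exp (f (cons a x)))).map (cons a)) := by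
    intro a
    rw [integrable_map_measure ψ.continuous.aestronglyMeasurable (hm a).aemeasurable, hdens,
      integrable_withDensity_iff_integrable_smul (hd a)]
    refine (hint (expCons f a * ψ.comp (consMap a))).congr (Eventually.of_forall fun x => ?_)
    simp [expCons, consMap, NNReal.smul_def, Real.coe_toNNReal _ (Real.exp_pos _).le]
  have hint' : ∀ a : Fin d,
      Integrable (fun x => Real.exp (f (cons a x)) * ψ (cons a x)) ν :=
    fun a => hint (expCons f a * ψ.comp (consMap a))
  rw [ruelleDual, integral_finsetSum_measure fun a _ => key a]
  simp only [ruelle_apply]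
  rw [integral_finsetSum _ fun a _ => hint' a]
  refine Finset.sum_congr rfl fun a _ => ?_
  rw [integral_map (hm a).aemeasurable ψ.continuous.aestronglyMeasurable, hdens,
    integral_withDensity_eq_integral_smul (hd a)]
  refine integral_congr_ae (Eventually.of_forall fun x => ?_)
  simp [NNReal.smul_def, Real.coe_toNNReal _ (Real.exp_pos _).le]

/-- `fbar = f + log φ - log φ∘σ - log λ`, where `φ` is a strictly positive continuous
eigenfunction of `L_f` with eigenvalue `λ > 0`. -/
structure IsNormalization (f φ : C(Config d, ℝ)) (lam : ℝ) (fbar : C(Config d, ℝ)) : Prop where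
  eigenfunction_pos : ∀ x, 0 < φ x
  eigenvalue_pos : 0 < lam
  eigen : ruelle f φ = lam • φ
  eq : ∀ x, fbar x = f x + Real.log (φ x) - Real.log (φ (shift x)) - Real.log lam

/-- The set `𝒢^*(f)` of dual-Gibbs probabilities: eigenprobabilities of `L_f^*`. -/
def dualGibbs (f : C(Config d, ℝ)) : Set (ProbabilityMeasure (Config d)) :=
  {ν | ∃ lam : ℝ, 0 < lam ∧
    ruelleDual f (ν : Measure (Config d)) = ENNReal.ofReal lam • (ν : Measure (Config d))}

/-! ### Entropy, pressure and equilibrium states -/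

/-- Shannon entropy of the join `⋁_{i<n} T⁻ⁱ ξ` of a finite partition
`ξ = {π⁻¹(0), …, π⁻¹(k-1)}`. -/
def joinEntropy {X : Type*} [MeasurableSpace X] (T : X → X) (μ : Measure X) {k : ℕ}
    (π : X → Fin k) (n : ℕ) : ℝ :=
  ∑ w : Fin n → Fin k, Real.negMulLog (μ.real {x | ∀ i : Fin n, π (T^[i] x) = w i})

/-- The Kolmogorov-Sinai entropy `sup_ξ lim_n (1/n) H(⋁_{i<n} T⁻ⁱ ξ)`, the supremum being over
finite measurable partitions. For invariant `μ` the limit exists, and it is the `limsup`. -/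
def entropy {X : Type*} [MeasurableSpace X] (T : X → X) (μ : Measure X) : EReal :=
  ⨆ (k : ℕ) (π : X → Fin k) (_ : Measurable π),
    limsup (fun n : ℕ => ((joinEntropy T μ π n / n : ℝ) : EReal)) atTop

/-- The set `ℳ(σ)` of shift-invariant probability measures. -/
def invariantMeasures (d : ℕ) : Set (ProbabilityMeasure (Config d)) :=
  {μ | MeasurePreserving shift (μ : Measure (Config d)) (μ : Measure (Config d))}

/-- `h(μ) + ∫ f dμ`. -/
def freeEnergy (f : C(Config d, ℝ)) (μ : ProbabilityMeasure (Config d)) : EReal :=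
  entropy shift (μ : Measure (Config d)) + ((∫ x, f x ∂(μ : Measure (Config d)) : ℝ) : EReal)

/-- The pressure `P(f)`. -/
def pressure (f : C(Config d, ℝ)) : EReal :=
  ⨆ μ ∈ invariantMeasures d, freeEnergy f μ

/-- The set of equilibrium states of `f`. -/
def equilibriumStates (f : C(Config d, ℝ)) : Set (ProbabilityMeasure (Config d)) :=
  {μ | μ ∈ invariantMeasures d ∧ freeEnergy f μ = pressure f}

/-! ### Specifications, thermodynamic limits and DLR measures

A specification is given by functions `U n = - β H_n` with `β = 1`. -/

/-- `Z_n^y = ∑_{σⁿ x = σⁿ y} exp (U_n x)`. -/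
def partitionFn (U : ℕ → Config d → ℝ) (n : ℕ) (y : Config d) : ℝ :=
  ∑ a : Fin n → Fin d, Real.exp (U n (glue a y))

/-- `K_n(·,y) = (Z_n^y)⁻¹ ∑_{σⁿ x = σⁿ y} exp (U_n x) δ_x`. -/
def kernelMeasure (U : ℕ → Config d → ℝ) (n : ℕ) (y : Config d) : Measure (Config d) :=
  (ENNReal.ofReal (partitionFn U n y))⁻¹ •
    ∑ a : Fin n → Fin d,
      ENNReal.ofReal (Real.exp (U n (glue a y))) • Measure.dirac (glue a y)

instance (U : ℕ → Config d → ℝ) (n : ℕ) (y : Config d) :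
    IsProbabilityMeasure (kernelMeasure U n y) := by
  constructor
  have hpos : 0 < partitionFn U n y :=
    Finset.sum_pos (fun a _ => Real.exp_pos _) ⟨fun i => y i, Finset.mem_univ _⟩
  have hsum : ∑ a : Fin n → Fin d, ENNReal.ofReal (Real.exp (U n (glue a y))) =
      ENNReal.ofReal (partitionFn U n y) :=
    (ENNReal.ofReal_sum_of_nonneg fun a _ => (Real.exp_pos _).le).symm
  simp only [kernelMeasure, Measure.smul_apply, Measure.finsetSum_apply, smul_eq_mul,
    measure_univ, mul_one, hsum]
  exact ENNReal.inv_mul_cancel (by simpa using hpos) ENNReal.ofReal_ne_top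

/-- `K_n(·,y)` as a point of the space of probability measures with the weak topology. -/
def gibbs (U : ℕ → Config d → ℝ) (n : ℕ) (y : Config d) : ProbabilityMeasure (Config d) :=
  ⟨kernelMeasure U n y, inferInstance⟩

/-- Weak limits of `K_{n_k}(·,y_k)` along strictly increasing sequences `n_k`. -/
def gibbsClusterPoints (U : ℕ → Config d → ℝ) : Set (ProbabilityMeasure (Config d)) :=
  {P | ∃ n : ℕ → ℕ, StrictMono n ∧ ∃ y : ℕ → Config d,
    Tendsto (fun k => gibbs U (n k) (y k)) atTop (𝓝 P)}

/-- `𝒢^{TL}`: the weak closure of the convex hull of the cluster points. -/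
def thermodynamicLimits (U : ℕ → Config d → ℝ) : Set (ProbabilityMeasure (Config d)) :=
  closure {P | (P : Measure (Config d)) ∈
    convexHull ℝ≥0 ((fun Q : ProbabilityMeasure (Config d) => (Q : Measure (Config d))) ''
      gibbsClusterPoints U)}

/-- The σ-algebra `σⁿ ℱ`, generated by the coordinates with index at least `n`. -/
abbrev tailAlgebra (d n : ℕ) : MeasurableSpace (Config d) :=
  MeasurableSpace.comap (shift^[n]) inferInstance

/-- `𝒢^{DLR}`: for all `n` and measurable `F`, `K_n(F,·)` is a version of `μ(F | σⁿ ℱ)`. -/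
def dlrMeasures (U : ℕ → Config d → ℝ) : Set (ProbabilityMeasure (Config d)) :=
  {μ | ∀ (n : ℕ) (F : Set (Config d)), MeasurableSet F →
    (μ : Measure (Config d))[F.indicator (fun _ => (1 : ℝ)) | tailAlgebra d n]
      =ᵐ[(μ : Measure (Config d))] fun y => (kernelMeasure U n y).real F}

/-- The specification of a potential: `-H_n = f + f∘σ + ⋯ + f∘σⁿ⁻¹`. -/
def potentialEnergy (f : C(Config d, ℝ)) (n : ℕ) (x : Config d) : ℝ :=
  birkhoffSum shift f n x

/-! ### Interactions -/

/-- An interaction: a family of functions indexed by the finite sets of sites. -/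
abbrev Interaction (d : ℕ) : Type := Finset ℕ → Config d → ℝ

open Classical in
/-- `∑ Φ_A(x)` over the sets `A ⊆ {0,…,N-1}` that meet `Λ_n = {0,…,n-1}`. -/
def interactionPartialEnergy (Φ : Interaction d) (n N : ℕ) (x : Config d) : ℝ :=
  ∑ A ∈ (Finset.range N).powerset with (A ∩ Finset.range n).Nonempty, Φ A x

/-- `-H_n(x) = ∑_{A ∩ Λ_n ≠ ∅} Φ_A(x)`, summed along the increasing volumes `{0,…,N-1}`. -/
def interactionEnergy (Φ : Interaction d) (n : ℕ) (x : Config d) : ℝ :=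
  limUnder atTop fun N : ℕ => interactionPartialEnergy Φ n N x

/-- `(x₀,…,x_{m-1},w_m,w_{m+1},…)`. -/
def splice (x w : Config d) (m : ℕ) : Config d := fun i => if i < m then x i else w i

/-- The set `{k, …, 2k+n+1}`, for `k, n ≥ 0`. With sites numbered from `1` instead of `0`,
these are the sets `{k, …, 2k+n}`, for `k ≥ 1`, `n ≥ 0`. -/
def progression (p : ℕ × ℕ) : Finset ℕ := Finset.Icc p.1 (2 * p.1 + p.2 + 1)

theorem progression_injective : Function.Injective progression := by
  rintro ⟨k, n⟩ ⟨l, m⟩ h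
  have h1 : k ∈ progression (l, m) := h ▸ by simp [progression]; omega
  have h2 : l ∈ progression (k, n) := h ▸ by simp [progression]; omega
  have h3 : 2 * k + n + 1 ∈ progression (l, m) := h ▸ by simp [progression]; omega
  have h4 : 2 * l + m + 1 ∈ progression (k, n) := h ▸ by simp [progression]; omega
  simp only [progression, Finset.mem_Icc] at h1 h2 h3 h4
  ext <;> simp only <;> omega

/-- The interaction term on `{k, …, 2k+n+1}`:
`f(x_k,…,x_{2k+n+1},w_{2k+n+2},…) - f(x_k,…,x_{2k+n},w_{2k+n+1},…)` if `n ≥ 1`, and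
`f(x_k,…,x_{2k+1},w_{2k+2},…) - f(w)` if `n = 0`. -/
def progressionTerm (f : C(Config d, ℝ)) (w : Config d) (p : ℕ × ℕ) (x : Config d) : ℝ :=
  f (shift^[p.1] (splice x w (2 * p.1 + p.2 + 2))) -
    if p.2 = 0 then f w else f (shift^[p.1] (splice x w (2 * p.1 + p.2 + 1)))

open Classical in
/-- The interaction `Φ^f` built from the potential `f` and the reference configuration `w`. -/
def potentialInteraction (f : C(Config d, ℝ)) (w : Config d) : Interaction d := fun A x =>
  if h : ∃ p, progression p = A then progressionTerm f w h.choose x else 0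

theorem potentialInteraction_progression (f : C(Config d, ℝ)) (w : Config d) (p : ℕ × ℕ) :
    potentialInteraction f w (progression p) = progressionTerm f w p := by
  funext x
  have h : ∃ q, progression q = progression p := ⟨p, rfl⟩
  rw [potentialInteraction, dif_pos h, progression_injective h.choose_spec]

end WaltersGibbs

end

open WaltersGibbs

namespace WaltersGibbs

variable {d : ℕ}

/-! ### Words and the iterated Ruelle operator -/

/-! Everything rests on bounded distortion: by the Walters condition, Birkhoff sums over two orbits
starting with the same word of length `n` differ by at most a constant `C`, and by at most `ε` if
`p(ε)` further symbols agree, uniformly in `n`. Hence `L_fⁿ 1` varies by a factor at most `e^C`, its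
logarithm at a point is additive up to `C`, and `l⁻ⁿ L_fⁿ 1` stays between two positive constants
for a suitable `l` (`exists_growth_rate`). A limit of Cesàro averages of these functions is a
positive eigenfunction `φ`. It is continuous because the `e^ε` ratio bounds on cylinders survive
averaging and limits (`exists_eigenfunction`).

Normalizing by `φ` gives `g` with `L_g 1 = 1`, so that `L_gⁿ` averages over words with probability
weights. Distortion makes the weights at two base points comparable, which is a Doeblin condition:
up to a small error the oscillation of `L_gⁿ ψ` contracts by a fixed factor
(`exists_oscillation_contraction`). Thus `L_gⁿ ψ → ∫ ψ dμ` uniformly. Since `L_fⁿ ψ = lⁿ φ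
L_gⁿ(ψ/φ)`, the ratios `L_fⁿ ψ / L_fⁿ 1` converge uniformly to `∫ ψ dν`, with `ν` proportional to
`μ/φ`. The notion `IsAsymptoticState` records this convergence.

Uniform convergence leaves only one candidate for a thermodynamic limit, a DLR measure or a dual
eigenprobability. Conversely, an eigenprobability is DLR by a change of variables
(`mem_dlrMeasures_of_eigen`). The interaction sums telescope to `S_n f - n f(w)`, and the additive
constant cancels in the kernels.

For equilibrium states it suffices to treat `g`, since `f - g` integrates to `log l` against every
invariant measure. Gibbs' inequality gives `h(m) ≤ -∫ g dm` for every invariant `m`, and the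
cylinder formula for `μ` gives the reverse inequality for `μ`. If `m` attains equality, applying the
upper bound to normalized perturbations of `g` shows `L_g^* m = m`, hence `m = μ`. -/

/-- The point `u x = (u₀,…,uₙ₋₁,x₀,x₁,…)`. -/
def prepend {n : ℕ} (u : Fin n → Fin d) (x : Config d) : Config d :=
  fun i => if h : i < n then u ⟨i, h⟩ else x (i - n)

theorem glue_eq_prepend {n : ℕ} (u : Fin n → Fin d) (y : Config d) :
    glue u y = prepend u (shift^[n] y) := by
  funext i
  by_cases h : i < n
  · simp [glue, prepend, h]
  · simp [glue, prepend, h, shift_iterate, Nat.sub_add_cancel (not_lt.mp h)]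

theorem shift_iterate_prepend {n : ℕ} (u : Fin n → Fin d) (x : Config d) :
    shift^[n] (prepend u x) = x := by
  funext i
  simp [shift_iterate, prepend]

theorem prepend_lt {n : ℕ} (u : Fin n → Fin d) (x : Config d) {i : ℕ} (h : i < n) :
    prepend u x i = u ⟨i, h⟩ := by simp [prepend, h]

theorem prepend_congr {n p : ℕ} (u : Fin n → Fin d) {x y : Config d}
    (h : ∀ i < p, x i = y i) : ∀ i < n + p, prepend u x i = prepend u y i := by
  intro i hi
  by_cases hn : i < n
  · simp [prepend, hn]
  · simp [prepend, hn, h (i - n) (by omega)]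

theorem continuous_prepend {n : ℕ} (u : Fin n → Fin d) :
    Continuous (prepend u : Config d → Config d) := by
  refine continuous_pi fun i => ?_
  by_cases h : i < n
  · simp only [prepend, h, dite_true]; exact continuous_const
  · simp only [prepend, h, dite_false]; exact continuous_apply _

theorem prepend_zero (u : Fin 0 → Fin d) (x : Config d) : prepend u x = x := by
  funext i; simp [prepend]

theorem prepend_cons {n : ℕ} (a : Fin d) (u : Fin n → Fin d) (x : Config d) :
    prepend (Fin.cons a u : Fin (n + 1) → Fin d) x = cons a (prepend u x) := by
  funext i
  cases i with
  | zero => simp [prepend, cons]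
  | succ i =>
    by_cases h : i < n
    · have : (⟨i + 1, Nat.succ_lt_succ h⟩ : Fin (n + 1)) = Fin.succ ⟨i, h⟩ := rfl
      simp only [prepend, cons, h, Nat.succ_lt_succ h, dite_true]
      rw [this, Fin.cons_succ]
    · simp [prepend, cons, h]

theorem shift_cons (a : Fin d) (x : Config d) : shift (cons a x) = x := rfl

theorem sum_words_succ {M : Type*} [AddCommMonoid M] {n : ℕ}
    (F : (Fin (n + 1) → Fin d) → M) :
    ∑ u, F u = ∑ a : Fin d, ∑ u : Fin n → Fin d, F (Fin.cons a u) := by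
  rw [← Fintype.sum_prod_type']
  exact (Fintype.sum_equiv (Fin.consEquiv fun _ => Fin d) _ _ fun _ => rfl).symm

theorem birkhoffSum_cons (f : Config d → ℝ) (n : ℕ) (a : Fin d) (x : Config d) :
    birkhoffSum shift f (n + 1) (cons a x) = f (cons a x) + birkhoffSum shift f n x := by
  rw [birkhoffSum_succ', shift_cons]

theorem continuous_birkhoffSum (f : C(Config d, ℝ)) (n : ℕ) :
    Continuous (birkhoffSum shift (⇑f) n) := by
  unfold birkhoffSum
  exact continuous_finsetSum _ fun i _ => f.continuous.comp (continuous_shift.iterate i)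

theorem ruelle_pow_apply (f ψ : C(Config d, ℝ)) (n : ℕ) (x : Config d) :
    (ruelle f ^ n) ψ x = ∑ u : Fin n → Fin d,
      Real.exp (birkhoffSum shift f n (prepend u x)) * ψ (prepend u x) := by
  induction n generalizing ψ with
  | zero => simp [prepend_zero]
  | succ n ih =>
    rw [pow_succ, mul_apply_eq_comp, ih, sum_words_succ, Finset.sum_comm]
    refine Finset.sum_congr rfl fun u _ => ?_
    rw [ruelle_apply, Finset.mul_sum]
    refine Finset.sum_congr rfl fun a _ => ?_
    rw [prepend_cons, birkhoffSum_cons, Real.exp_add]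
    ring

theorem ruelle_pow_one_pos [NeZero d] (f : C(Config d, ℝ)) (n : ℕ) (x : Config d) :
    0 < (ruelle f ^ n) 1 x := by
  rw [ruelle_pow_apply]
  exact Finset.sum_pos (fun u _ => by simpa using Real.exp_pos _) ⟨fun _ => 0, Finset.mem_univ _⟩

theorem ruelle_pow_mono (f : C(Config d, ℝ)) (n : ℕ) {ψ χ : C(Config d, ℝ)}
    (h : ∀ x, ψ x ≤ χ x) (x : Config d) : (ruelle f ^ n) ψ x ≤ (ruelle f ^ n) χ x := by
  rw [ruelle_pow_apply, ruelle_pow_apply]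
  exact Finset.sum_le_sum fun u _ => mul_le_mul_of_nonneg_left (h _) (Real.exp_pos _).le

theorem ruelle_pow_const (f : C(Config d, ℝ)) (n : ℕ) (c : ℝ) (x : Config d) :
    (ruelle f ^ n) (ContinuousMap.const _ c) x = c * (ruelle f ^ n) 1 x := by
  simp only [ruelle_pow_apply, Finset.mul_sum, ContinuousMap.const_apply, ContinuousMap.one_apply]
  exact Finset.sum_congr rfl fun u _ => by ring

/-! ### Iterates of the dual operator and the finite-volume kernels. -/

theorem lintegral_ruelleDual (f : C(Config d, ℝ)) (m : Measure (Config d))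
    {h : Config d → ℝ≥0∞} (hh : Measurable h) :
    ∫⁻ x, h x ∂(ruelleDual f m) =
      ∑ a : Fin d, ∫⁻ x, ENNReal.ofReal (Real.exp (f (cons a x))) * h (cons a x) ∂m := by
  rw [ruelleDual, lintegral_finsetSum_measure]
  refine Finset.sum_congr rfl fun a _ => ?_
  have hc := (continuous_cons a).measurable
  rw [lintegral_map hh hc]
  exact lintegral_withDensity_eq_lintegral_mul _
    (expCons f a).continuous.measurable.ennreal_ofReal (hh.comp hc)

theorem measurable_exp_birkhoffSum_prepend (f : C(Config d, ℝ)) {n : ℕ} (u : Fin n → Fin d) :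
    Measurable fun x =>
      ENNReal.ofReal (Real.exp (birkhoffSum shift f n (prepend u x))) :=
  (Real.continuous_exp.comp
    ((continuous_birkhoffSum f n).comp (continuous_prepend u))).measurable.ennreal_ofReal

theorem lintegral_ruelleDual_iterate (f : C(Config d, ℝ)) (m : Measure (Config d)) (n : ℕ)
    {h : Config d → ℝ≥0∞} (hh : Measurable h) :
    ∫⁻ x, h x ∂((ruelleDual f)^[n] m) =
      ∑ u : Fin n → Fin d, ∫⁻ x,
        ENNReal.ofReal (Real.exp (birkhoffSum shift f n (prepend u x))) * h (prepend u x) ∂m := by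
  induction n generalizing h with
  | zero => simp [prepend_zero]
  | succ n ih =>
    rw [Function.iterate_succ_apply', lintegral_ruelleDual _ _ hh, sum_words_succ]
    refine Finset.sum_congr rfl fun a _ => ?_
    rw [ih]
    · refine Finset.sum_congr rfl fun u _ => lintegral_congr fun x => ?_
      rw [prepend_cons, birkhoffSum_cons, Real.exp_add, ENNReal.ofReal_mul (Real.exp_pos _).le]
      ring
    · exact (expCons f a).continuous.measurable.ennreal_ofReal.mul
        (hh.comp (continuous_cons a).measurable)

theorem partitionFn_potentialEnergy (f : C(Config d, ℝ)) (n : ℕ) (y : Config d) :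
    partitionFn (potentialEnergy f) n y = (ruelle f ^ n) 1 (shift^[n] y) := by
  rw [ruelle_pow_apply]
  simp [partitionFn, potentialEnergy, glue_eq_prepend]

theorem kernelMeasure_potentialEnergy (f : C(Config d, ℝ)) (n : ℕ) (y : Config d) :
    kernelMeasure (potentialEnergy f) n y =
      (ENNReal.ofReal ((ruelle f ^ n) 1 (shift^[n] y)))⁻¹ •
        (ruelleDual f)^[n] (Measure.dirac (shift^[n] y)) := by
  rw [kernelMeasure, partitionFn_potentialEnergy]
  congr 1
  refine Measure.ext fun s hs => ?_
  have hm : Measurable (s.indicator (1 : Config d → ℝ≥0∞)) := measurable_one.indicator hs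
  rw [← lintegral_indicator_one hs (μ := (ruelleDual f)^[n] _),
    lintegral_ruelleDual_iterate _ _ _ hm, Measure.finsetSum_apply]
  refine Finset.sum_congr rfl fun u _ => ?_
  have hd := lintegral_dirac' (shift^[n] y) ((measurable_exp_birkhoffSum_prepend f u).mul
    (hm.comp (continuous_prepend u).measurable))
  refine Eq.trans ?_ hd.symm
  simp [glue_eq_prepend, potentialEnergy, hs]

theorem integral_kernelMeasure_potentialEnergy (f ψ : C(Config d, ℝ)) (n : ℕ) (y : Config d) :
    ∫ x, ψ x ∂(kernelMeasure (potentialEnergy f) n y) =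
      (ruelle f ^ n) ψ (shift^[n] y) / (ruelle f ^ n) 1 (shift^[n] y) := by
  have hpos : 0 ≤ (ruelle f ^ n) 1 (shift^[n] y) := by
    rw [ruelle_pow_apply]
    exact Finset.sum_nonneg fun u _ => by simpa using (Real.exp_pos _).le
  rw [kernelMeasure, partitionFn_potentialEnergy, integral_smul_measure,
    integral_finsetSum_measure]
  · rw [ruelle_pow_apply f ψ, ENNReal.toReal_inv, ENNReal.toReal_ofReal hpos, smul_eq_mul,
      inv_mul_eq_div]
    congr 1
    refine Finset.sum_congr rfl fun u _ => ?_
    rw [integral_smul_measure, integral_dirac, ENNReal.toReal_ofReal (Real.exp_pos _).le,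
      glue_eq_prepend, smul_eq_mul, potentialEnergy]
  · intro u _
    exact (integrable_dirac (by simp)).smul_measure ENNReal.ofReal_ne_top

theorem integrable_continuousMap (ψ : C(Config d, ℝ)) (m : Measure (Config d))
    [IsFiniteMeasure m] : Integrable (fun x => ψ x) m :=
  ψ.continuous.integrable_of_hasCompactSupport (HasCompactSupport.of_compactSpace _)

theorem integral_ruelle_pow_of_eigen {f : C(Config d, ℝ)} {m : Measure (Config d)}
    [IsFiniteMeasure m] {c : ℝ} (hc : 0 < c) (h : ruelleDual f m = ENNReal.ofReal c • m)
    (n : ℕ) (ψ : C(Config d, ℝ)) :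
    ∫ x, (ruelle f ^ n) ψ x ∂m = c ^ n * ∫ x, ψ x ∂m := by
  induction n with
  | zero => simp
  | succ n ih =>
    rw [pow_succ', mul_apply_eq_comp, ← integral_ruelleDual, h,
      integral_smul_measure, ih, ENNReal.toReal_ofReal hc.le, smul_eq_mul, pow_succ', mul_assoc]

theorem ruelleDual_iterate_of_eigen {f : C(Config d, ℝ)} {m : Measure (Config d)}
    {c : ℝ≥0∞} (h : ruelleDual f m = c • m) (n : ℕ) :
    (ruelleDual f)^[n] m = c ^ n • m := by
  have hs : ∀ (b : ℝ≥0∞) (m' : Measure (Config d)),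
      ruelleDual f (b • m') = b • ruelleDual f m' := fun b m' => by
    simp only [ruelleDual, Finset.smul_sum]
    refine Finset.sum_congr rfl fun a _ => ?_
    rw [withDensity_smul_measure, Measure.map_smul]
  induction n with
  | zero => simp
  | succ n ih => rw [Function.iterate_succ_apply', ih, hs, h, smul_smul, pow_succ]

/-! ### Consequences of uniform convergence of the finite-volume measures -/

/-- Uniformly in `x`, `L_fⁿ ψ (x) / L_fⁿ 1 (x)` converges to `∫ ψ dν`. -/
def IsAsymptoticState (f : C(Config d, ℝ)) (ν : ProbabilityMeasure (Config d)) : Prop :=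
  ∀ (ψ : C(Config d, ℝ)) (ε : ℝ), 0 < ε → ∃ N : ℕ, ∀ n ≥ N, ∀ x,
    |(ruelle f ^ n) ψ x - (∫ z, ψ z ∂(ν : Measure (Config d))) * (ruelle f ^ n) 1 x| ≤
      ε * (ruelle f ^ n) 1 x

theorem probabilityMeasure_ext {μ ν : ProbabilityMeasure (Config d)}
    (h : ∀ ψ : C(Config d, ℝ), ∫ x, ψ x ∂(μ : Measure (Config d)) =
      ∫ x, ψ x ∂(ν : Measure (Config d))) : μ = ν := by
  apply ProbabilityMeasure.toMeasure_injective
  exact ext_of_forall_integral_eq_of_IsFiniteMeasure fun ψ => h ψ.toContinuousMap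

theorem measure_ext_continuousMap {μ ν : Measure (Config d)} [IsFiniteMeasure μ]
    [IsFiniteMeasure ν] (h : ∀ ψ : C(Config d, ℝ), ∫ x, ψ x ∂μ = ∫ x, ψ x ∂ν) : μ = ν :=
  ext_of_forall_integral_eq_of_IsFiniteMeasure fun ψ => h ψ.toContinuousMap

theorem tendsto_probabilityMeasure_iff {ι : Type*} {l : Filter ι}
    {P : ι → ProbabilityMeasure (Config d)} {ν : ProbabilityMeasure (Config d)} :
    Tendsto P l (𝓝 ν) ↔ ∀ ψ : C(Config d, ℝ),
      Tendsto (fun k => ∫ x, ψ x ∂(P k : Measure (Config d))) l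
        (𝓝 (∫ x, ψ x ∂(ν : Measure (Config d)))) := by
  rw [ProbabilityMeasure.tendsto_iff_forall_integral_tendsto]
  exact ⟨fun h ψ => h (BoundedContinuousFunction.mkOfCompact ψ), fun h ψ => h ψ.toContinuousMap⟩

theorem gibbs_congr {U V : ℕ → Config d → ℝ}
    (h : ∀ n y, kernelMeasure U n y = kernelMeasure V n y) : gibbs U = gibbs V := by
  funext n y
  exact Subtype.ext (h n y)

theorem thermodynamicLimits_congr {U V : ℕ → Config d → ℝ}
    (h : ∀ n y, kernelMeasure U n y = kernelMeasure V n y) :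
    thermodynamicLimits U = thermodynamicLimits V := by
  simp only [thermodynamicLimits, gibbsClusterPoints, gibbs_congr h]

theorem dlrMeasures_congr {U V : ℕ → Config d → ℝ}
    (h : ∀ n y, kernelMeasure U n y = kernelMeasure V n y) :
    dlrMeasures U = dlrMeasures V := by
  simp only [dlrMeasures, h]

section

variable [NeZero d] {f : C(Config d, ℝ)} {ν : ProbabilityMeasure (Config d)}

/-- The boundary condition may change with `k`, because the convergence in `IsAsymptoticState` is
uniform in the base point. -/
theorem IsAsymptoticState.tendsto_gibbs (h : IsAsymptoticState f ν) {n : ℕ → ℕ}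
    (hn : Tendsto n atTop atTop) (y : ℕ → Config d) :
    Tendsto (fun k => gibbs (potentialEnergy f) (n k) (y k)) atTop (𝓝 ν) := by
  rw [tendsto_probabilityMeasure_iff]
  intro ψ
  rw [Metric.tendsto_atTop]
  intro ε hε
  obtain ⟨N, hN⟩ := h ψ (ε / 2) (half_pos hε)
  obtain ⟨K, hK⟩ := eventually_atTop.1 (hn.eventually_ge_atTop N)
  refine ⟨K, fun k hk => ?_⟩
  have hpos := ruelle_pow_one_pos f (n k) (shift^[n k] (y k))
  have := hN (n k) (hK k hk) (shift^[n k] (y k))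
  change dist (∫ x, ψ x ∂(kernelMeasure (potentialEnergy f) (n k) (y k))) _ < ε
  rw [integral_kernelMeasure_potentialEnergy, Real.dist_eq, div_sub' hpos.ne', abs_div,
    abs_of_pos hpos, div_lt_iff₀ hpos, mul_comm ((ruelle f ^ n k) 1 _)]
  refine this.trans_lt ?_
  exact mul_lt_mul_of_pos_right (half_lt_self hε) hpos

theorem IsAsymptoticState.thermodynamicLimits_eq (h : IsAsymptoticState f ν) :
    thermodynamicLimits (potentialEnergy f) = {ν} := by
  have hc : gibbsClusterPoints (potentialEnergy f) = {ν} := by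
    ext P
    constructor
    · rintro ⟨n, hn, y, hy⟩
      exact tendsto_nhds_unique hy (h.tendsto_gibbs hn.tendsto_atTop y)
    · rintro rfl
      exact ⟨id, strictMono_id, fun _ _ => 0, h.tendsto_gibbs tendsto_id _⟩
  have hs : {P : ProbabilityMeasure (Config d) | (P : Measure (Config d)) ∈
      convexHull ℝ≥0 ((fun Q : ProbabilityMeasure (Config d) => (Q : Measure (Config d))) ''
        gibbsClusterPoints (potentialEnergy f))} = {ν} := by
    ext P
    rw [hc, Set.image_singleton, convexHull_singleton]
    exact ProbabilityMeasure.toMeasure_injective.eq_iff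
  rw [thermodynamicLimits, hs, closure_singleton]

/-- The error in `IsAsymptoticState` is relative to `L_fⁿ 1`, whose integral against an
eigenprobability `m` with eigenvalue `c` is `cⁿ`. Integrating the estimate against `m` and dividing
by `cⁿ` therefore leaves an error `ε`, whatever `c` is. -/
theorem IsAsymptoticState.dualGibbs_eq (h : IsAsymptoticState f ν) {lam : ℝ} (hl : 0 < lam)
    (hν : ruelleDual f (ν : Measure (Config d)) = ENNReal.ofReal lam • (ν : Measure (Config d))) :
    dualGibbs f = {ν} := by
  ext m
  refine ⟨?_, ?_⟩
  · rintro ⟨c, hc, hm⟩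
    refine probabilityMeasure_ext fun ψ => ?_
    refine eq_of_forall_dist_le fun ε hε => ?_
    obtain ⟨N, hN⟩ := h ψ ε hε
    have h1 := integral_ruelle_pow_of_eigen hc hm N ψ
    have h2 := integral_ruelle_pow_of_eigen hc hm N 1
    set I := ∫ z, ψ z ∂(ν : Measure (Config d))
    have h2' : ∫ x, (ruelle f ^ N) 1 x ∂(m : Measure (Config d)) = c ^ N := by
      rw [h2]; simp
    have hcN : 0 < c ^ N := pow_pos hc N
    have key : |c ^ N * (∫ x, ψ x ∂(m : Measure (Config d))) - I * c ^ N| ≤ ε * c ^ N := by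
      rw [← h1, ← h2', ← integral_const_mul, ← integral_const_mul,
        ← integral_sub (integrable_continuousMap _ _)
          ((integrable_continuousMap _ _).const_mul _)]
      refine (abs_integral_le_integral_abs).trans ?_
      refine integral_mono ?_ ((integrable_continuousMap _ _).const_mul _) (hN N le_rfl)
      exact ((integrable_continuousMap _ _).sub ((integrable_continuousMap _ _).const_mul _)).abs
    rw [mul_comm I, ← mul_sub, abs_mul, abs_of_pos hcN, mul_comm ε] at key
    exact le_of_mul_le_mul_left key hcN
  · rintro rfl
    exact ⟨lam, hl, hν⟩

end

/-! ### DLR measures of a potential. -/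

theorem measurable_shift_iterate (n : ℕ) : Measurable (shift^[n] : Config d → Config d) :=
  (continuous_shift.iterate n).measurable

theorem clopen_of_mem_measurableCylinders {F : Set (Config d)}
    (hF : F ∈ measurableCylinders fun _ : ℕ => Fin d) : IsClopen F := by
  obtain ⟨s, S, -, rfl⟩ := (mem_measurableCylinders _).1 hF
  have : IsClopen S := isClopen_discrete S
  exact this.preimage (continuous_pi fun i => continuous_apply _)


/-- The indicator function of a clopen set as a continuous map. -/
noncomputable def clopenIndicator {F : Set (Config d)} (hF : IsClopen F) : C(Config d, ℝ) :=
  ⟨F.indicator fun _ => 1, hF.continuous_indicator continuous_const⟩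

theorem integral_clopenIndicator {F : Set (Config d)} (hF : IsClopen F)
    (m : Measure (Config d)) : ∫ x, clopenIndicator hF x ∂m = m.real F :=
  integral_indicator_one hF.isOpen.measurableSet

theorem IsAsymptoticState.abs_kernelMeasure_sub_le [NeZero d] {f : C(Config d, ℝ)}
    {ν : ProbabilityMeasure (Config d)} (h : IsAsymptoticState f ν) {F : Set (Config d)}
    (hF : IsClopen F) {ε : ℝ} (hε : 0 < ε) :
    ∃ n, ∀ y, |(kernelMeasure (potentialEnergy f) n y).real F -
      (ν : Measure (Config d)).real F| ≤ ε := by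
  obtain ⟨n, hn⟩ := h (clopenIndicator hF) ε hε
  refine ⟨n, fun y => ?_⟩
  have hpos := ruelle_pow_one_pos f n (shift^[n] y)
  have := hn n le_rfl (shift^[n] y)
  rwa [← integral_clopenIndicator hF, ← integral_clopenIndicator hF,
    integral_kernelMeasure_potentialEnergy, div_sub' hpos.ne', abs_div, abs_of_pos hpos,
    div_le_iff₀ hpos, mul_comm ((ruelle f ^ n) 1 _)]

theorem measure_ext_clopen {μ ν : ProbabilityMeasure (Config d)}
    (h : ∀ F : Set (Config d), IsClopen F →
      (μ : Measure (Config d)).real F = (ν : Measure (Config d)).real F) : μ = ν := by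
  apply ProbabilityMeasure.toMeasure_injective
  refine ext_of_generate_finite (measurableCylinders fun _ : ℕ => Fin d)
    generateFrom_measurableCylinders.symm isPiSystem_measurableCylinders (fun F hF => ?_)
    (by simp)
  have := h F (clopen_of_mem_measurableCylinders hF)
  rwa [measureReal_def, measureReal_def, ENNReal.toReal_eq_toReal_iff' (measure_ne_top _ _)
    (measure_ne_top _ _)] at this

theorem tailAlgebra_le (n : ℕ) : tailAlgebra d n ≤ (inferInstance : MeasurableSpace (Config d)) :=
  (measurable_shift_iterate n).comap_le

/-- Integrating the DLR equation makes `m(F)` an average of the values `K_n(F,y)`. For clopen `F`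
the indicator is continuous, so these values are uniformly close to `ν(F)` for large `n`. Clopen
sets determine the measure. -/
theorem IsAsymptoticState.eq_of_mem_dlrMeasures [NeZero d] {f : C(Config d, ℝ)}
    {ν m : ProbabilityMeasure (Config d)} (h : IsAsymptoticState f ν)
    (hm : m ∈ dlrMeasures (potentialEnergy f)) : m = ν := by
  refine measure_ext_clopen fun F hF => ?_
  refine eq_of_forall_dist_le fun ε hε => ?_
  obtain ⟨n, hn⟩ := h.abs_kernelMeasure_sub_le hF hε
  have hae := hm n F hF.isOpen.measurableSet
  have h1 : (m : Measure (Config d)).real F =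
      ∫ y, (kernelMeasure (potentialEnergy f) n y).real F ∂(m : Measure (Config d)) := by
    rw [← integral_congr_ae hae, integral_condExp (tailAlgebra_le n)]
    exact (integral_indicator_one hF.isOpen.measurableSet).symm
  have hint : Integrable (fun y => (kernelMeasure (potentialEnergy f) n y).real F)
      (m : Measure (Config d)) := integrable_condExp.congr hae
  have h2 : (m : Measure (Config d)).real F - (ν : Measure (Config d)).real F =
      ∫ y, ((kernelMeasure (potentialEnergy f) n y).real F - (ν : Measure (Config d)).real F)
        ∂(m : Measure (Config d)) := by
    rw [integral_sub hint (integrable_const _), ← h1]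
    simp
  rw [Real.dist_eq, h2]
  have h3 := norm_integral_le_of_norm_le_const (μ := (m : Measure (Config d)))
    (f := fun y => (kernelMeasure (potentialEnergy f) n y).real F -
      (ν : Measure (Config d)).real F) (Eventually.of_forall hn)
  simpa using h3

/-- `L_fⁿ 1_F (x)` for a measurable set `F`. -/
noncomputable def ruelleWeight (f : C(Config d, ℝ)) (n : ℕ) (F : Set (Config d))
    (x : Config d) : ℝ≥0∞ :=
  ∑ u : Fin n → Fin d, ENNReal.ofReal (Real.exp (birkhoffSum shift f n (prepend u x))) *
    F.indicator 1 (prepend u x)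

theorem measurable_ruelleWeight (f : C(Config d, ℝ)) (n : ℕ) {F : Set (Config d)}
    (hF : MeasurableSet F) : Measurable (ruelleWeight f n F) :=
  Finset.measurable_sum _ fun u _ => (measurable_exp_birkhoffSum_prepend f u).mul
    ((measurable_one.indicator hF).comp (continuous_prepend u).measurable)

theorem ruelleWeight_univ (f : C(Config d, ℝ)) (n : ℕ) (x : Config d) :
    ruelleWeight f n Set.univ x = ENNReal.ofReal ((ruelle f ^ n) 1 x) := by
  simp only [ruelleWeight, ruelle_pow_apply, Set.indicator_univ, Pi.one_apply, mul_one,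
    ContinuousMap.one_apply]
  exact (ENNReal.ofReal_sum_of_nonneg fun u _ => (Real.exp_pos _).le).symm

theorem kernelMeasure_apply (f : C(Config d, ℝ)) (n : ℕ) (y : Config d) {F : Set (Config d)}
    (hF : MeasurableSet F) : kernelMeasure (potentialEnergy f) n y F =
      (ENNReal.ofReal ((ruelle f ^ n) 1 (shift^[n] y)))⁻¹ *
        ruelleWeight f n F (shift^[n] y) := by
  rw [kernelMeasure, partitionFn_potentialEnergy, Measure.smul_apply, Measure.finsetSum_apply,
    smul_eq_mul, ruelleWeight]
  simp [glue_eq_prepend, potentialEnergy, hF]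

/-- Test `L_f^{*n} m = c m` on `(k ∘ σⁿ) 1_F`: on every preimage of `x` under `σⁿ` the first factor
has the value `k x`, so it comes out of the sum over words. -/
theorem mul_lintegral_comp_shift_iterate {f : C(Config d, ℝ)} {m : Measure (Config d)}
    {c : ℝ≥0∞} {n : ℕ} (h : (ruelleDual f)^[n] m = c • m) {k : Config d → ℝ≥0∞}
    (hk : Measurable k) {F : Set (Config d)} (hF : MeasurableSet F) :
    c * ∫⁻ y, k (shift^[n] y) * F.indicator 1 y ∂m = ∫⁻ x, k x * ruelleWeight f n F x ∂m := by
  have h1 : Measurable (F.indicator (1 : Config d → ℝ≥0∞)) := measurable_one.indicator hF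
  have hm : Measurable fun y => k (shift^[n] y) * F.indicator (1 : Config d → ℝ≥0∞) y :=
    (hk.comp (measurable_shift_iterate n)).mul h1
  rw [← smul_eq_mul, ← lintegral_smul_measure, ← h, lintegral_ruelleDual_iterate _ _ _ hm,
    ← lintegral_finsetSum]
  · refine lintegral_congr fun x => ?_
    rw [ruelleWeight, Finset.mul_sum]
    refine Finset.sum_congr rfl fun u _ => ?_
    rw [shift_iterate_prepend]
    ring
  · intro u _
    exact (measurable_exp_birkhoffSum_prepend f u).mul
      (hm.comp (continuous_prepend u).measurable)

/-- As a function of `y` the kernel is `k ∘ σⁿ` with `k = L_fⁿ 1_F / L_fⁿ 1`, hence tail measurable.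
What remains is its integral over tail sets. -/
theorem mem_dlrMeasures_of_eigen [NeZero d] {f : C(Config d, ℝ)}
    {ν : ProbabilityMeasure (Config d)} {lam : ℝ} (hl : 0 < lam)
    (hν : ruelleDual f (ν : Measure (Config d)) = ENNReal.ofReal lam • (ν : Measure (Config d))) :
    ν ∈ dlrMeasures (potentialEnergy f) := by
  intro n F hF
  let m : Measure (Config d) := (ν : Measure (Config d))
  have hm := ruelleDual_iterate_of_eigen hν n
  set c := ENNReal.ofReal lam ^ n
  have hc0 : c ≠ 0 := pow_ne_zero _ (by simpa using hl)
  have hct : c ≠ ⊤ := ENNReal.pow_ne_top ENNReal.ofReal_ne_top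
  let k : Config d → ℝ≥0∞ := fun x =>
    (ENNReal.ofReal ((ruelle f ^ n) 1 x))⁻¹ * ruelleWeight f n F x
  have hkm : Measurable k :=
    (((ruelle f ^ n) 1).continuous.measurable.ennreal_ofReal.inv).mul (measurable_ruelleWeight f n hF)
  have hk : ∀ y, kernelMeasure (potentialEnergy f) n y F = k (shift^[n] y) :=
    fun y => kernelMeasure_apply f n y hF
  have hreal : (fun y => (kernelMeasure (potentialEnergy f) n y).real F) =
      fun y => (k (shift^[n] y)).toReal := by
    funext y
    rw [measureReal_def, hk]
  have hk1 : ∀ y, k (shift^[n] y) ≤ 1 := fun y => by rw [← hk]; exact prob_le_one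
  have hmeas : Measurable[tailAlgebra d n] fun y => (k (shift^[n] y)).toReal :=
    hkm.ennreal_toReal.comp (comap_measurable _)
  rw [hreal]
  have hbd : Integrable (fun y => (k (shift^[n] y)).toReal) m := by
    refine Integrable.of_bound (C := 1)
      (hmeas.mono (tailAlgebra_le n) le_rfl).aestronglyMeasurable (Eventually.of_forall fun y => ?_)
    rw [Real.norm_of_nonneg ENNReal.toReal_nonneg]
    exact ENNReal.toReal_le_of_le_ofReal zero_le_one (by simpa using hk1 y)
  refine (ae_eq_condExp_of_forall_setIntegral_eq (tailAlgebra_le n)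
    ((integrable_const _).indicator hF) (fun _ _ _ => hbd.integrableOn) ?_
    hmeas.stronglyMeasurable.aestronglyMeasurable).symm
  rintro _ ⟨B, hB, rfl⟩ -
  have hA : MeasurableSet (shift^[n] ⁻¹' B : Set (Config d)) := measurable_shift_iterate n hB
  have hB1 : Measurable (B.indicator (1 : Config d → ℝ≥0∞)) := measurable_one.indicator hB
  have key : ∫⁻ y in shift^[n] ⁻¹' B, k (shift^[n] y) ∂m = m (F ∩ shift^[n] ⁻¹' B) := by
    -- The two changes of variables have the same right-hand side because `k · L_fⁿ 1 = L_fⁿ 1_F`.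
    -- Cancelling the eigenvalue power compares the left-hand sides.
    have e1 := mul_lintegral_comp_shift_iterate hm (hB1.mul hkm) MeasurableSet.univ
    have e2 := mul_lintegral_comp_shift_iterate hm hB1 hF
    have e3 : ∫⁻ x, ((B.indicator 1 : Config d → ℝ≥0∞) * k) x * ruelleWeight f n Set.univ x ∂m =
        ∫⁻ x, B.indicator 1 x * ruelleWeight f n F x ∂m := by
      refine lintegral_congr fun x => ?_
      have hp : ENNReal.ofReal ((ruelle f ^ n) 1 x) ≠ 0 := by
        simpa using ruelle_pow_one_pos f n x
      rw [ruelleWeight_univ, Pi.mul_apply, mul_assoc, mul_right_comm,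
        ENNReal.inv_mul_cancel hp ENNReal.ofReal_ne_top, one_mul]
    rw [e3, ← e2] at e1
    have e4 := (ENNReal.mul_right_inj hc0 hct).1 e1
    rw [← lintegral_indicator hA, ← lintegral_indicator_one (hF.inter hA)]
    convert e4 using 3 with y y
    · by_cases hy : shift^[n] y ∈ B <;> simp [Set.indicator, hy]
    · by_cases hy : shift^[n] y ∈ B <;> by_cases hy' : y ∈ F <;> simp [Set.indicator, hy, hy']
  rw [integral_toReal (f := fun y => k (shift^[n] y)) (hkm.comp (measurable_shift_iterate n)).aemeasurable
    (Eventually.of_forall fun y => (hk1 y).trans_lt ENNReal.one_lt_top), key,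
    setIntegral_indicator hF, setIntegral_const, smul_eq_mul, mul_one, measureReal_def,
    Set.inter_comm]

theorem IsAsymptoticState.dlrMeasures_eq [NeZero d] {f : C(Config d, ℝ)}
    {ν : ProbabilityMeasure (Config d)} (h : IsAsymptoticState f ν) {lam : ℝ} (hl : 0 < lam)
    (hν : ruelleDual f (ν : Measure (Config d)) = ENNReal.ofReal lam • (ν : Measure (Config d))) :
    dlrMeasures (potentialEnergy f) = {ν} := by
  ext m
  refine ⟨fun hm => h.eq_of_mem_dlrMeasures hm, ?_⟩
  rintro rfl
  exact mem_dlrMeasures_of_eigen hl hν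

/-! ### The interaction built from a potential -/

theorem sum_progressionTerm (f : C(Config d, ℝ)) (w x : Config d) (k M : ℕ) :
    ∑ j ∈ Finset.range (M + 1), progressionTerm f w (k, j) x =
      f (shift^[k] (splice x w (2 * k + M + 2))) - f w := by
  induction M with
  | zero => simp [progressionTerm]
  | succ M ih =>
    rw [Finset.sum_range_succ, ih, progressionTerm, if_neg (by simp)]
    have : 2 * k + (M + 1) + 1 = 2 * k + M + 2 := by ring
    simp only [this]
    ring

/-- Only the sets `{k,…,2k+j+1}` carry a term. Such a set lies in `{0,…,N-1}` exactly when `j < N -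
2k - 1`, and it meets `{0,…,n-1}` exactly when `k < n`. For each `k` the sum over `j` telescopes;
`2n ≤ N` ensures that it is not empty. -/
theorem interactionPartialEnergy_eq (f : C(Config d, ℝ)) (w x : Config d) {n N : ℕ}
    (hN : 2 * n ≤ N) :
    interactionPartialEnergy (potentialInteraction f w) n N x =
      ∑ k ∈ Finset.range n, (f (shift^[k] (splice x w N)) - f w) := by
  classical
  have h1 : interactionPartialEnergy (potentialInteraction f w) n N x =
      ∑ k ∈ Finset.range n, ∑ j ∈ Finset.range (N - 2 * k - 1),
        progressionTerm f w (k, j) x := by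
    rw [Finset.sum_sigma', interactionPartialEnergy]
    symm
    refine Finset.sum_of_injOn (fun p : (_ : ℕ) × ℕ => progression (p.1, p.2)) ?_ ?_ ?_ ?_
    · rintro ⟨k, j⟩ - ⟨l, i⟩ - h
      have := progression_injective h
      simp only [Prod.mk.injEq] at this
      obtain ⟨rfl, rfl⟩ := this
      rfl
    · rintro ⟨k, j⟩ h
      simp only [Finset.coe_sigma, Set.mem_sigma_iff, Finset.coe_range, Set.mem_Iio] at h
      simp only [Finset.coe_filter, Finset.mem_powerset, Set.mem_ofPred_eq]
      refine ⟨fun i hi => ?_, k, ?_⟩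
      · simp only [progression, Finset.mem_Icc] at hi
        rw [Finset.mem_range]
        omega
      · simp only [progression, Finset.mem_inter, Finset.mem_Icc, Finset.mem_range]
        omega
    · intro A hA hA'
      rw [potentialInteraction, dif_neg]
      rintro ⟨⟨k, j⟩, rfl⟩
      apply hA'
      simp only [Finset.mem_filter, Finset.mem_powerset] at hA
      obtain ⟨hA1, i, hi⟩ := hA
      have h2 : 2 * k + j + 1 ∈ progression (k, j) := by simp [progression]; omega
      have h3 := Finset.mem_range.1 (hA1 h2)
      simp only [progression, Finset.mem_inter, Finset.mem_Icc, Finset.mem_range] at hi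
      refine ⟨⟨k, j⟩, ?_, rfl⟩
      simp only [Finset.coe_sigma, Set.mem_sigma_iff, Finset.coe_range, Set.mem_Iio]
      omega
    · rintro ⟨k, j⟩ -
      rw [potentialInteraction_progression]
  rw [h1]
  refine Finset.sum_congr rfl fun k hk => ?_
  have hk' := Finset.mem_range.1 hk
  obtain ⟨M, hM⟩ : ∃ M, N = 2 * k + M + 2 := ⟨N - 2 * k - 2, by omega⟩
  have : N - 2 * k - 1 = M + 1 := by omega
  rw [this, sum_progressionTerm, hM]

theorem tendsto_splice (x w : Config d) : Tendsto (fun N => splice x w N) atTop (𝓝 x) := by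
  rw [tendsto_pi_nhds]
  intro i
  refine tendsto_const_nhds.congr' ?_
  filter_upwards [eventually_gt_atTop i] with N hN
  simp [splice, hN]

theorem tendsto_interactionPartialEnergy (f : C(Config d, ℝ)) (w x : Config d) (n : ℕ) :
    Tendsto (fun N => interactionPartialEnergy (potentialInteraction f w) n N x) atTop
      (𝓝 (potentialEnergy f n x - n * f w)) := by
  have h : Tendsto (fun N => ∑ k ∈ Finset.range n, (f (shift^[k] (splice x w N)) - f w)) atTop
      (𝓝 (∑ k ∈ Finset.range n, (f (shift^[k] x) - f w))) :=
    tendsto_finsetSum _ fun k _ =>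
      (((f.continuous.comp (continuous_shift.iterate k)).tendsto x).comp
        (tendsto_splice x w)).sub_const _
  have h2 : ∑ k ∈ Finset.range n, (f (shift^[k] x) - f w) = potentialEnergy f n x - n * f w := by
    simp [potentialEnergy, birkhoffSum]
  rw [← h2]
  refine h.congr' ?_
  filter_upwards [eventually_ge_atTop (2 * n)] with N hN
  rw [interactionPartialEnergy_eq f w x hN]

theorem interactionEnergy_eq (f : C(Config d, ℝ)) (w x : Config d) (n : ℕ) :
    interactionEnergy (potentialInteraction f w) n x = potentialEnergy f n x - n * f w :=
  (tendsto_interactionPartialEnergy f w x n).limUnder_eq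

theorem kernelMeasure_sub_const (U : ℕ → Config d → ℝ) (c : ℕ → ℝ) (n : ℕ) (y : Config d) :
    kernelMeasure (fun n x => U n x - c n) n y = kernelMeasure U n y := by
  have hc : ENNReal.ofReal (Real.exp (c n))⁻¹ ≠ 0 := by
    simpa using Real.exp_pos _
  have hc' : ENNReal.ofReal (Real.exp (c n))⁻¹ ≠ ⊤ := ENNReal.ofReal_ne_top
  have h1 : ∀ x, ENNReal.ofReal (Real.exp (U n x - c n)) =
      ENNReal.ofReal (Real.exp (c n))⁻¹ * ENNReal.ofReal (Real.exp (U n x)) := fun x => by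
    rw [← ENNReal.ofReal_mul (by positivity), Real.exp_sub, div_eq_inv_mul]
  have h2 : partitionFn (fun n x => U n x - c n) n y =
      (Real.exp (c n))⁻¹ * partitionFn U n y := by
    simp only [partitionFn, Finset.mul_sum, Real.exp_sub, div_eq_inv_mul]
  have h3 : ∀ a b : ℝ≥0∞, a ≠ 0 → a ≠ ⊤ → (a * b)⁻¹ * a = b⁻¹ := fun a b ha ha' => by
    rw [ENNReal.mul_inv (Or.inl ha) (Or.inl ha'), mul_right_comm, ENNReal.inv_mul_cancel ha ha',
      one_mul]
  rw [kernelMeasure, kernelMeasure, h2, ENNReal.ofReal_mul (by positivity)]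
  simp only [h1, ← smul_smul, ← Finset.smul_sum]
  rw [smul_smul, h3 _ _ hc hc']

theorem kernelMeasure_interactionEnergy (f : C(Config d, ℝ)) (w : Config d) (n : ℕ)
    (y : Config d) :
    kernelMeasure (interactionEnergy (potentialInteraction f w)) n y =
      kernelMeasure (potentialEnergy f) n y := by
  have : interactionEnergy (potentialInteraction f w) =
      fun n x => potentialEnergy f n x - n * f w := by
    funext n x
    exact interactionEnergy_eq f w x n
  rw [this, kernelMeasure_sub_const _ (fun n => n * f w)]

/-! ### Bounded distortion -/

/-- `var_{n+p}(S_n f) → 0` as `p → ∞`, uniformly in `n`. -/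
def UniformDistortion (f : Config d → ℝ) : Prop :=
  ∀ ε : ℝ, 0 < ε → ∃ p : ℕ, ∀ (n : ℕ) (x y : Config d), (∀ i < n + p, x i = y i) →
    |birkhoffSum shift f n x - birkhoffSum shift f n y| ≤ ε

theorem IsWalters.uniformDistortion {f : Config d → ℝ} (hf : IsWalters f) :
    UniformDistortion f := by
  intro ε hε
  have h := (ENNReal.tendsto_nhds_zero.1 hf) (ENNReal.ofReal ε) (by simpa using hε)
  obtain ⟨p, hp⟩ := h.exists
  refine ⟨p, fun n x y hxy => ?_⟩
  -- The Walters supremum runs over `n ≥ 1` only; at `n = 0` both sums vanish.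
  rcases Nat.eq_zero_or_pos n with rfl | hn
  · simpa using hε.le
  · have h1 : ENNReal.ofReal |birkhoffSum shift f n x - birkhoffSum shift f n y| ≤
        variation (n + p) (birkhoffSum shift f n) := by
      unfold variation
      exact le_iSup_of_le x (le_iSup_of_le y (le_iSup_of_le hxy le_rfl))
    have h2 := h1.trans ((le_iSup₂_of_le n hn le_rfl).trans hp)
    exact (ENNReal.ofReal_le_ofReal_iff hε.le).1 h2

theorem exists_abs_sub_le_of_agree (ψ : C(Config d, ℝ)) {ε : ℝ} (hε : 0 < ε) :
    ∃ p : ℕ, ∀ x y : Config d, (∀ i < p, x i = y i) → |ψ x - ψ y| ≤ ε := by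
  let _ : MetricSpace (Config d) := PiNat.metricSpace (E := fun _ => Fin d)
  have hu : UniformContinuous ψ := CompactSpace.uniformContinuous_of_continuous ψ.continuous
  obtain ⟨δ, hδ, h⟩ := Metric.uniformContinuous_iff.1 hu ε hε
  obtain ⟨p, hp⟩ := exists_pow_lt_of_lt_one hδ (one_half_lt_one (α := ℝ))
  refine ⟨p, fun x y hxy => (h (lt_of_le_of_lt ?_ hp)).le⟩
  exact PiNat.mem_cylinder_iff_dist_le.1 fun i hi => hxy i hi

theorem shift_iterate_agree {n p : ℕ} {x y : Config d} (h : ∀ i < n + p, x i = y i) :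
    ∀ i < p, shift^[n] x i = shift^[n] y i := fun i hi => by
  rw [shift_iterate, shift_iterate, h _ (by omega)]

/-- Agreement on `n` symbols is agreement on `(n - p) + p` symbols, so the first `n - p` terms
differ in total by at most `1`, and the last `p` terms by at most `2p‖f‖`. -/
theorem UniformDistortion.exists_bound {f : C(Config d, ℝ)} (hf : UniformDistortion f) :
    ∃ C : ℝ, 0 < C ∧ ∀ (n : ℕ) (x y : Config d), (∀ i < n, x i = y i) →
      |birkhoffSum shift f n x - birkhoffSum shift f n y| ≤ C := by
  obtain ⟨p, hp⟩ := hf 1 one_pos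
  have hb : ∀ m x, |birkhoffSum shift f m x| ≤ m * ‖f‖ := fun m x => by
    unfold birkhoffSum
    refine (Finset.abs_sum_le_sum_abs _ _).trans ?_
    refine (Finset.sum_le_card_nsmul _ _ ‖f‖ fun i _ => f.norm_coe_le_norm _).trans ?_
    simp
  refine ⟨1 + 2 * (p * ‖f‖), by positivity, fun n x y hxy => ?_⟩
  have hf0 := norm_nonneg f
  rcases le_total n p with h | h
  · have h1 := hb n x
    have h2 := hb n y
    have h3 : (n : ℝ) * ‖f‖ ≤ p * ‖f‖ :=
      mul_le_mul_of_nonneg_right (by exact_mod_cast h) hf0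
    have := abs_sub (birkhoffSum shift f n x) (birkhoffSum shift f n y)
    linarith
  · obtain ⟨m, rfl⟩ := Nat.exists_eq_add_of_le' h
    rw [birkhoffSum_add, birkhoffSum_add]
    have h1 := hb p (shift^[m] x)
    have h2 := hb p (shift^[m] y)
    have h3 := hp m x y hxy
    rw [abs_le] at h1 h2 h3 ⊢
    constructor <;> linarith [h1.1, h1.2, h2.1, h2.2, h3.1, h3.2]

theorem birkhoffSum_coboundary {f g h : Config d → ℝ} {c : ℝ}
    (hg : ∀ x, g x = f x + h x - h (shift x) - c) (n : ℕ) (x : Config d) :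
    birkhoffSum shift g n x = birkhoffSum shift f n x + h x - h (shift^[n] x) - n * c := by
  induction n with
  | zero => simp
  | succ n ih =>
    rw [birkhoffSum_succ, birkhoffSum_succ, ih, hg, Function.iterate_succ_apply']
    push_cast
    ring

theorem UniformDistortion.coboundary {f g : Config d → ℝ} (h : C(Config d, ℝ)) {c : ℝ}
    (hf : UniformDistortion f) (hg : ∀ x, g x = f x + h x - h (shift x) - c) :
    UniformDistortion g := by
  intro ε hε
  obtain ⟨p, hp⟩ := hf (ε / 3) (by positivity)
  obtain ⟨q, hq⟩ := exists_abs_sub_le_of_agree h (show 0 < ε / 3 by positivity)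
  refine ⟨max p q, fun n x y hxy => ?_⟩
  have h1 := hp n x y fun i hi => hxy i (by have := le_max_left p q; omega)
  have h2 := hq x y fun i hi => hxy i (by have := le_max_right p q; omega)
  have h3 := hq (shift^[n] x) (shift^[n] y)
    (shift_iterate_agree fun i hi => hxy i (by have := le_max_right p q; omega))
  rw [birkhoffSum_coboundary hg, birkhoffSum_coboundary hg]
  rw [abs_le] at h1 h2 h3 ⊢
  constructor <;> linarith [h1.1, h1.2, h2.1, h2.2, h3.1, h3.2]

/-! ### Existence of a positive eigenfunction -/

/-- Both `c + C` and `C - c` are subadditive. By Fekete their slopes converge to their infima, and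
the two limits are opposite. The two infimum bounds give the estimate with the same constant `C`. -/
theorem exists_linear_approx_of_quasiadditive {c : ℕ → ℝ} {C : ℝ}
    (h : ∀ m n, |c (m + n) - c m - c n| ≤ C) : ∃ l : ℝ, ∀ n, |c n - n * l| ≤ C := by
  have hu : Subadditive fun n => c n + C := fun m n => by
    have := (abs_le.1 (h m n)).2
    linarith
  have hw : Subadditive fun n => C - c n := fun m n => by
    have := (abs_le.1 (h m n)).1
    linarith
  have hu1 := fun k => hu.apply_mul_add_le k 1 0
  have hw1 := fun k => hw.apply_mul_add_le k 1 0
  simp only [mul_one, add_zero] at hu1 hw1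
  have hc0 := abs_le.1 (h 0 0)
  simp only [add_zero] at hc0
  have bu : BddBelow (Set.range fun n : ℕ => (c n + C) / n) := by
    -- The `0` accounts for `n = 0`, where the quotient is `0` by convention.
    refine ⟨min 0 (c 1 - C), ?_⟩
    rintro _ ⟨n, rfl⟩
    rcases Nat.eq_zero_or_pos n with rfl | hn
    · simp
    · refine (min_le_right _ _).trans ?_
      have hn' : (0 : ℝ) < n := by exact_mod_cast hn
      rw [le_div_iff₀ hn']
      nlinarith [hw1 n]
  have bw : BddBelow (Set.range fun n : ℕ => (C - c n) / n) := by
    refine ⟨min 0 (-c 1 - C), ?_⟩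
    rintro _ ⟨n, rfl⟩
    rcases Nat.eq_zero_or_pos n with rfl | hn
    · simp
    · refine (min_le_right _ _).trans ?_
      have hn' : (0 : ℝ) < n := by exact_mod_cast hn
      rw [le_div_iff₀ hn']
      nlinarith [hu1 n]
  have tu := hu.tendsto_lim bu
  have tw := hw.tendsto_lim bw
  have hsum : hu.lim + hw.lim = 0 := by
    refine tendsto_nhds_unique (tu.add tw) ?_
    have : Tendsto (fun n : ℕ => 2 * C / (n : ℝ)) atTop (𝓝 0) :=
      tendsto_const_div_atTop_nhds_zero_nat _
    refine this.congr fun n => ?_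
    rw [← add_div]
    ring_nf
  refine ⟨hu.lim, fun n => ?_⟩
  rcases Nat.eq_zero_or_pos n with rfl | hn
  · simp only [Nat.cast_zero, zero_mul, sub_zero]
    have := h 0 0
    simpa using this
  · have hn' : (0 : ℝ) < n := by exact_mod_cast hn
    have h1 := hu.lim_le_div bu hn.ne'
    have h2 := hw.lim_le_div bw hn.ne'
    rw [le_div_iff₀ hn'] at h1 h2
    have h3 : hw.lim = -hu.lim := by linarith
    rw [h3] at h2
    rw [abs_le]
    constructor <;> linarith

theorem continuous_of_agree {h : Config d → ℝ}
    (hh : ∀ ε : ℝ, 0 < ε → ∃ p : ℕ, ∀ x y : Config d, (∀ i < p, x i = y i) → |h x - h y| ≤ ε) :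
    Continuous h := by
  rw [continuous_iff_continuousAt]
  intro x
  rw [ContinuousAt, Metric.tendsto_nhds]
  intro ε hε
  obtain ⟨p, hp⟩ := hh (ε / 2) (half_pos hε)
  have hev : ∀ᶠ y in 𝓝 x, ∀ i < p, y i = x i := by
    refine (eventually_all_finite (Set.finite_lt_nat p)).2 fun i _ => ?_
    have ho : IsOpen {y : Config d | y i ∈ ({x i} : Set (Fin d))} :=
      (isOpen_discrete _).preimage (continuous_apply i)
    exact ho.mem_nhds rfl
  filter_upwards [hev] with y hy
  exact (hp y x hy).trans_lt (half_lt_self hε)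

theorem ruelle_pow_one_le_exp_mul {f : C(Config d, ℝ)} {n p : ℕ} {ε : ℝ}
    (h : ∀ x y : Config d, (∀ i < n + p, x i = y i) →
      |birkhoffSum shift f n x - birkhoffSum shift f n y| ≤ ε)
    {x y : Config d} (hxy : ∀ i < p, x i = y i) :
    (ruelle f ^ n) 1 x ≤ Real.exp ε * (ruelle f ^ n) 1 y := by
  rw [ruelle_pow_apply, ruelle_pow_apply, Finset.mul_sum]
  refine Finset.sum_le_sum fun u _ => ?_
  simp only [ContinuousMap.one_apply, mul_one]
  rw [← Real.exp_add, Real.exp_le_exp]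
  have := (abs_le.1 (h _ _ (prepend_congr u hxy))).2
  linarith

theorem ruelle_pow_add_apply (f ψ : C(Config d, ℝ)) (m n : ℕ) (x : Config d) :
    (ruelle f ^ (m + n)) ψ x = (ruelle f ^ m) ((ruelle f ^ n) ψ) x := by
  rw [pow_add, mul_apply_eq_comp]

/-- Since `L_fⁿ 1` is constant up to a factor `e^C`, writing `L_f^{m+n} 1 = L_f^m (L_fⁿ 1)` shows
that `log L_fⁿ 1 (x₀)` is additive up to `C`. -/
theorem exists_growth_rate [NeZero d] {f : C(Config d, ℝ)} (hf : UniformDistortion f) :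
    ∃ (l M : ℝ), 0 < l ∧ 0 < M ∧ ∀ n x,
      l ^ n * M⁻¹ ≤ (ruelle f ^ n) 1 x ∧ (ruelle f ^ n) 1 x ≤ l ^ n * M := by
  obtain ⟨C, hC, hbd⟩ := hf.exists_bound
  have hr : ∀ n x y, (ruelle f ^ n) 1 x ≤ Real.exp C * (ruelle f ^ n) 1 y := fun n x y =>
    ruelle_pow_one_le_exp_mul (p := 0) (fun x y => hbd n x y) (by simp)
  let x₀ : Config d := fun _ => 0
  have hpos := fun n => ruelle_pow_one_pos f n x₀
  have hup : ∀ m n, (ruelle f ^ (m + n)) 1 x₀ ≤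
      Real.exp C * (ruelle f ^ n) 1 x₀ * (ruelle f ^ m) 1 x₀ := fun m n => by
    rw [ruelle_pow_add_apply, ← ruelle_pow_const]
    exact ruelle_pow_mono f m (fun x => hr n x x₀) x₀
  have hlo : ∀ m n, Real.exp (-C) * (ruelle f ^ n) 1 x₀ * (ruelle f ^ m) 1 x₀ ≤
      (ruelle f ^ (m + n)) 1 x₀ := fun m n => by
    rw [ruelle_pow_add_apply, ← ruelle_pow_const]
    refine ruelle_pow_mono f m (fun x => ?_) x₀
    rw [ContinuousMap.const_apply, Real.exp_neg, inv_mul_le_iff₀ (Real.exp_pos _)]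
    exact hr n x₀ x
  obtain ⟨s, hs⟩ := exists_linear_approx_of_quasiadditive
    (c := fun n => Real.log ((ruelle f ^ n) 1 x₀)) (C := C) (fun m n => by
      have e1 := Real.log_le_log (hpos _) (hup m n)
      have e2 := Real.log_le_log (by have := hpos m; have := hpos n; positivity) (hlo m n)
      rw [Real.log_mul (by have := hpos n; positivity) (hpos m).ne',
        Real.log_mul (Real.exp_pos _).ne' (hpos n).ne', Real.log_exp] at e1 e2
      rw [abs_le]
      constructor <;> linarith)
  -- One `C` comes from the linear approximation at `x₀`, the other from moving from `x₀` to `x`.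
  refine ⟨Real.exp s, Real.exp (2 * C), Real.exp_pos _, Real.exp_pos _, fun n x => ?_⟩
  have h1 := abs_le.1 (hs n)
  have e : Real.exp (Real.log ((ruelle f ^ n) 1 x₀)) = (ruelle f ^ n) 1 x₀ :=
    Real.exp_log (hpos n)
  rw [← Real.exp_neg, ← Real.exp_nat_mul, ← Real.exp_add, ← Real.exp_add]
  constructor
  · have : Real.exp (n * s + -(2 * C)) ≤ Real.exp (-C) * (ruelle f ^ n) 1 x₀ := by
      rw [← e, ← Real.exp_add, Real.exp_le_exp]
      linarith
    refine this.trans ?_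
    rw [Real.exp_neg, inv_mul_le_iff₀ (Real.exp_pos _)]
    exact hr n x₀ x
  · refine (hr n x x₀).trans ?_
    rw [← e, ← Real.exp_add, Real.exp_le_exp]
    linarith

theorem exists_eigenfunction [NeZero d] {f : C(Config d, ℝ)} (hf : UniformDistortion f) :
    ∃ (φ : C(Config d, ℝ)) (l : ℝ), (∀ x, 0 < φ x) ∧ 0 < l ∧ ruelle f φ = l • φ := by
  obtain ⟨l, M, hl, hM, hgr⟩ := exists_growth_rate hf
  let A : ℕ → C(Config d, ℝ) := fun N =>
    ((N : ℝ) + 1)⁻¹ • ∑ n ∈ Finset.range (N + 1), (l ^ n)⁻¹ • (ruelle f ^ n) 1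
  have hA : ∀ N x, A N x =
      ((N : ℝ) + 1)⁻¹ * ∑ n ∈ Finset.range (N + 1), (l ^ n)⁻¹ * (ruelle f ^ n) 1 x := by
    intro N x
    simp [A]
  have hlow : ∀ n x, M⁻¹ ≤ (l ^ n)⁻¹ * (ruelle f ^ n) 1 x := fun n x => by
    rw [le_inv_mul_iff₀ (pow_pos hl n)]; exact (hgr n x).1
  have hupp : ∀ n x, (l ^ n)⁻¹ * (ruelle f ^ n) 1 x ≤ M := fun n x => by
    rw [inv_mul_le_iff₀ (pow_pos hl n)]; exact (hgr n x).2
  have hmem : ∀ N x, A N x ∈ Set.Icc M⁻¹ M := fun N x => by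
    have hN : (0 : ℝ) < N + 1 := by positivity
    rw [hA, Set.mem_Icc, le_inv_mul_iff₀ hN, inv_mul_le_iff₀ hN]
    constructor
    · have := Finset.card_nsmul_le_sum (Finset.range (N + 1)) _ M⁻¹ fun n _ => hlow n x
      simpa using this
    · have := Finset.sum_le_card_nsmul (Finset.range (N + 1)) _ M fun n _ => hupp n x
      simpa using this
  -- A single ultrafilter serves all points. Pointwise limits suffice, because `L_f` at a point is a
  -- finite sum and continuity is proved afterwards from `hratio`.
  have hlim : ∀ x, ∃ a ∈ Set.Icc M⁻¹ M, Tendsto (fun N => A N x) (hyperfilter ℕ : Filter ℕ) (𝓝 a) :=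
    fun x => isCompact_Icc.ultrafilter_le_nhds ((hyperfilter ℕ).map fun N => A N x)
      (le_principal_iff.2 (Filter.Eventually.of_forall (f := (hyperfilter ℕ : Filter ℕ))
        fun N => hmem N x))
  choose φ hφmem hφ using hlim
  have hφpos : ∀ x, 0 < φ x := fun x => (inv_pos.2 hM).trans_le (hφmem x).1
  have hratio : ∀ ε : ℝ, 0 < ε → ∃ p : ℕ, ∀ x y : Config d, (∀ i < p, x i = y i) →
      φ x ≤ Real.exp ε * φ y := by
    intro ε hε
    obtain ⟨p, hp⟩ := hf ε hε
    refine ⟨p, fun x y hxy => ?_⟩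
    refine le_of_tendsto_of_tendsto (hφ x) ((hφ y).const_mul _) (Eventually.of_forall fun N => ?_)
    simp only [hA]
    rw [mul_left_comm, Finset.mul_sum _ _ (Real.exp ε)]
    have hN : (0 : ℝ) ≤ ((N : ℝ) + 1)⁻¹ := by positivity
    refine mul_le_mul_of_nonneg_left (Finset.sum_le_sum fun n _ => ?_) hN
    rw [mul_left_comm]
    exact mul_le_mul_of_nonneg_left (ruelle_pow_one_le_exp_mul (hp n) hxy)
      (inv_nonneg.2 (pow_pos hl n).le)
  have hcont : Continuous φ := by
    have : Continuous fun x => Real.log (φ x) := by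
      refine continuous_of_agree fun ε hε => ?_
      obtain ⟨p, hp⟩ := hratio ε hε
      refine ⟨p, fun x y hxy => ?_⟩
      have h1 := Real.log_le_log (hφpos x) (hp x y hxy)
      have h2 := Real.log_le_log (hφpos y) (hp y x fun i hi => (hxy i hi).symm)
      rw [Real.log_mul (Real.exp_pos _).ne' (hφpos _).ne', Real.log_exp] at h1 h2
      rw [abs_le]
      constructor <;> linarith
    refine (Real.continuous_exp.comp this).congr fun x => Real.exp_log (hφpos x)
  refine ⟨⟨φ, hcont⟩, l, hφpos, hl, ?_⟩
  ext x
  have t1 : Tendsto (fun N => ruelle f (A N) x) (hyperfilter ℕ : Filter ℕ)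
      (𝓝 (ruelle f ⟨φ, hcont⟩ x)) := by
    simp only [ruelle_apply]
    exact tendsto_finsetSum _ fun a _ => (hφ _).const_mul _
  -- Applying `L_f` to a Cesàro average shifts the summation index; the two end terms are bounded
  -- and are divided by `N + 1`.
  have t2 : Tendsto (fun N : ℕ => l * A N x +
      l * ((l ^ (N + 1))⁻¹ * (ruelle f ^ (N + 1)) 1 x - 1) * (1 / ((N : ℝ) + 1)))
      (hyperfilter ℕ : Filter ℕ) (𝓝 (l * φ x + 0)) := by
    refine ((hφ x).const_mul l).add ?_
    refine bdd_le_mul_tendsto_zero' (l * (M + 1)) (Eventually.of_forall fun N => ?_)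
      (tendsto_one_div_add_atTop_nhds_zero_nat.mono_left Nat.hyperfilter_le_atTop)
    rw [abs_mul, abs_of_pos hl]
    refine mul_le_mul_of_nonneg_left ?_ hl.le
    have h1 := hlow (N + 1) x
    have h2 := hupp (N + 1) x
    have h3 := inv_pos.2 hM
    rw [abs_le]
    constructor <;> linarith
  have he : ∀ N, ruelle f (A N) x = l * A N x +
      l * ((l ^ (N + 1))⁻¹ * (ruelle f ^ (N + 1)) 1 x - 1) * (1 / ((N : ℝ) + 1)) := by
    intro N
    have h1 : ruelle f (A N) x = ((N : ℝ) + 1)⁻¹ *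
        ∑ n ∈ Finset.range (N + 1), l * ((l ^ (n + 1))⁻¹ * (ruelle f ^ (n + 1)) 1 x) := by
      simp only [A, map_smul, map_sum, ContinuousMap.smul_apply, ContinuousMap.sum_apply,
        smul_eq_mul]
      congr 1
      refine Finset.sum_congr rfl fun n _ => ?_
      rw [pow_succ' (ruelle f), mul_apply_eq_comp, pow_succ' l]
      field_simp
    have h2 := Finset.sum_range_succ' (fun n => (l ^ n)⁻¹ * (ruelle f ^ n) 1 x) (N + 1)
    rw [Finset.sum_range_succ] at h2
    simp only [pow_zero, inv_one, one_mul, one_apply_eq_self, ContinuousMap.one_apply] at h2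
    rw [h1, hA, ← Finset.mul_sum]
    have h3 : ∑ n ∈ Finset.range (N + 1), (l ^ (n + 1))⁻¹ * (ruelle f ^ (n + 1)) 1 x =
        ∑ n ∈ Finset.range (N + 1), (l ^ n)⁻¹ * (ruelle f ^ n) 1 x +
          ((l ^ (N + 1))⁻¹ * (ruelle f ^ (N + 1)) 1 x - 1) := by linarith
    rw [h3]
    ring
  simp only [← he, add_zero] at t2
  simpa using tendsto_nhds_unique t1 t2

/-! ### Convergence for normalized potentials -/

section Normalized

variable {g : C(Config d, ℝ)}

theorem ruelle_pow_one_of_normalized (hg : ruelle g 1 = 1) (n : ℕ) : (ruelle g ^ n) 1 = 1 := by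
  induction n with
  | zero => rfl
  | succ n ih => rw [pow_succ, mul_apply_eq_comp, hg, ih]

theorem sum_exp_birkhoffSum_of_normalized (hg : ruelle g 1 = 1) (n : ℕ) (x : Config d) :
    ∑ u : Fin n → Fin d, Real.exp (birkhoffSum shift g n (prepend u x)) = 1 := by
  have := congrArg (fun ψ : C(Config d, ℝ) => ψ x) (ruelle_pow_one_of_normalized hg n)
  simpa only [ruelle_pow_apply, ContinuousMap.one_apply, mul_one] using this

theorem ruelle_pow_le_of_le (hg : ruelle g 1 = 1) {ψ : C(Config d, ℝ)} {c : ℝ}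
    (h : ∀ x, ψ x ≤ c) (n : ℕ) (x : Config d) : (ruelle g ^ n) ψ x ≤ c := by
  have := ruelle_pow_mono g n (χ := ContinuousMap.const _ c) h x
  rwa [ruelle_pow_const, ruelle_pow_one_of_normalized hg, ContinuousMap.one_apply,
    mul_one] at this

theorem le_ruelle_pow_of_le (hg : ruelle g 1 = 1) {ψ : C(Config d, ℝ)} {c : ℝ}
    (h : ∀ x, c ≤ ψ x) (n : ℕ) (x : Config d) : c ≤ (ruelle g ^ n) ψ x := by
  have := ruelle_pow_mono g n (ψ := ContinuousMap.const _ c) h x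
  rwa [ruelle_pow_const, ruelle_pow_one_of_normalized hg, ContinuousMap.one_apply,
    mul_one] at this

theorem abs_exp_sub_exp_le {a b η : ℝ} (h : |a - b| ≤ η) (hη : η ≤ 1) :
    |Real.exp a - Real.exp b| ≤ 2 * η * Real.exp b := by
  have h1 : Real.exp a - Real.exp b = (Real.exp (a - b) - 1) * Real.exp b := by
    rw [sub_mul, ← Real.exp_add]; simp
  rw [h1, abs_mul, abs_of_pos (Real.exp_pos b)]
  refine mul_le_mul_of_nonneg_right ?_ (Real.exp_pos b).le
  exact (Real.abs_exp_sub_one_le (h.trans hη)).trans (by linarith)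

/-- The difference of the values at `x` and `y` splits into a change of `ψ` under fixed weights and
a relative change `2η` of the weights. As the weights sum to `1`, neither contribution depends on
`n`. The choice of `η` gives `2η‖ψ‖ ≤ ε/2`. -/
theorem ruelle_pow_equicontinuous (hg : ruelle g 1 = 1) (hd : UniformDistortion g)
    (ψ : C(Config d, ℝ)) {ε : ℝ} (hε : 0 < ε) :
    ∃ p : ℕ, ∀ (n : ℕ) (x y : Config d), (∀ i < p, x i = y i) →
      |(ruelle g ^ n) ψ x - (ruelle g ^ n) ψ y| ≤ ε := by
  set η : ℝ := min 1 (ε / (4 * (‖ψ‖ + 1))) with hη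
  have hψ : 0 ≤ ‖ψ‖ := norm_nonneg ψ
  have hη0 : 0 < η := lt_min one_pos (by positivity)
  obtain ⟨p, hp⟩ := hd η hη0
  obtain ⟨q, hq⟩ := exists_abs_sub_le_of_agree ψ (half_pos hε)
  refine ⟨max p q, fun n x y hxy => ?_⟩
  rw [ruelle_pow_apply, ruelle_pow_apply, ← Finset.sum_sub_distrib]
  have hterm : ∀ u : Fin n → Fin d,
      |Real.exp (birkhoffSum shift g n (prepend u x)) * ψ (prepend u x) -
        Real.exp (birkhoffSum shift g n (prepend u y)) * ψ (prepend u y)| ≤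
      Real.exp (birkhoffSum shift g n (prepend u x)) * (ε / 2) +
        2 * η * Real.exp (birkhoffSum shift g n (prepend u y)) * ‖ψ‖ := by
    intro u
    have hag := prepend_congr u hxy
    have e1 := hp n (prepend u x) (prepend u y) fun i hi =>
      hag i (by have := le_max_left p q; omega)
    have e2 := hq (prepend u x) (prepend u y) fun i hi =>
      hag i (by have := le_max_right p q; omega)
    have e3 := abs_exp_sub_exp_le e1 (min_le_left _ _)
    have e4 := ψ.norm_coe_le_norm (prepend u y)
    rw [Real.norm_eq_abs] at e4
    set s := Real.exp (birkhoffSum shift g n (prepend u x))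
    set t := Real.exp (birkhoffSum shift g n (prepend u y))
    have hs : 0 < s := Real.exp_pos _
    have : s * ψ (prepend u x) - t * ψ (prepend u y) =
        s * (ψ (prepend u x) - ψ (prepend u y)) + (s - t) * ψ (prepend u y) := by ring
    rw [this]
    refine (abs_add_le _ _).trans (add_le_add ?_ ?_)
    · rw [abs_mul, abs_of_pos hs]
      exact mul_le_mul_of_nonneg_left e2 hs.le
    · rw [abs_mul]
      exact mul_le_mul e3 e4 (abs_nonneg _) ((abs_nonneg _).trans e3)
  refine (Finset.abs_sum_le_sum_abs _ _).trans ((Finset.sum_le_sum fun u _ => hterm u).trans ?_)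
  rw [Finset.sum_add_distrib, ← Finset.sum_mul, ← Finset.sum_mul, ← Finset.mul_sum,
    sum_exp_birkhoffSum_of_normalized hg, sum_exp_birkhoffSum_of_normalized hg]
  have h1 : η * (4 * (‖ψ‖ + 1)) ≤ ε := by
    rw [← le_div_iff₀ (by positivity)]
    exact min_le_right _ _
  nlinarith

/-- Doeblin's argument with `κ = e^{-C}`. The weights of words of length `p` at `x` dominate `κ`
times those at `y`. Replacing `h(ux)` by `h(uy)` costs `ε`, since `ux` and `uy` share `p` symbols;
then the common part `κ` cancels, and only mass `1 - κ` sees the oscillation `r`. -/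
theorem exists_oscillation_contraction (hg : ruelle g 1 = 1) (hd : UniformDistortion g) :
    ∃ κ : ℝ, 0 < κ ∧ κ < 1 ∧ ∀ (ψ : C(Config d, ℝ)) (ε : ℝ), 0 < ε → ∃ p : ℕ, ∀ (n : ℕ) (r : ℝ),
      (∀ x y, (ruelle g ^ n) ψ x - (ruelle g ^ n) ψ y ≤ r) →
      ∀ x y, (ruelle g ^ (p + n)) ψ x - (ruelle g ^ (p + n)) ψ y ≤ ε + (1 - κ) * r := by
  obtain ⟨C, hC, hbd⟩ := hd.exists_bound
  refine ⟨Real.exp (-C), Real.exp_pos _, by simpa using hC, fun ψ ε hε => ?_⟩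
  obtain ⟨p, hp⟩ := ruelle_pow_equicontinuous hg hd ψ hε
  refine ⟨p, fun n r hr x y => ?_⟩
  set h := (ruelle g ^ n) ψ with hh
  set κ := Real.exp (-C)
  rw [ruelle_pow_add_apply, ruelle_pow_add_apply, ← hh]
  set P : Config d → (Fin p → Fin d) → ℝ :=
    fun x u => Real.exp (birkhoffSum shift g p (prepend u x)) with hP
  have hP0 : ∀ x u, 0 < P x u := fun x u => Real.exp_pos _
  have hP1 : ∀ x, ∑ u, P x u = 1 := sum_exp_birkhoffSum_of_normalized hg p
  have hκ : ∀ u, κ * P y u ≤ P x u := fun u => by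
    have := hbd p (prepend u x) (prepend u y) (prepend_congr (p := 0) u (by simp))
    simp only [hP, κ, ← Real.exp_add, Real.exp_le_exp]
    linarith [(abs_le.1 this).1]
  have e1 : (ruelle g ^ p) h x ≤ ε + ∑ u, P x u * h (prepend u y) := by
    rw [ruelle_pow_apply]
    have : ε = ∑ u, P x u * ε := by rw [← Finset.sum_mul, hP1, one_mul]
    rw [this, ← Finset.sum_add_distrib]
    refine Finset.sum_le_sum fun u _ => ?_
    rw [← mul_add]
    refine mul_le_mul_of_nonneg_left ?_ (hP0 x u).le
    have hag := prepend_congr (p := 0) u (x := x) (y := y) (by simp)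
    have := (abs_le.1 (hp n (prepend u x) (prepend u y) hag)).2
    linarith
  set a := (ruelle g ^ p) h y with ha
  have ha' : a = ∑ u, P y u * h (prepend u y) := ruelle_pow_apply _ _ _ _
  have e2 : ∀ z, h z ≤ r + a := fun z => by
    -- The value `a` is an average of `h`, so it is within `r` of every value of `h`.
    have := le_ruelle_pow_of_le hg (ψ := h) (c := h z - r) (fun w => by linarith [hr z w]) p y
    linarith
  have e3 : ∑ u, (P x u - κ * P y u) * h (prepend u y) ≤ ∑ u, (P x u - κ * P y u) * (r + a) :=
    Finset.sum_le_sum fun u _ => mul_le_mul_of_nonneg_left (e2 _) (by linarith [hκ u])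
  rw [← Finset.sum_mul, Finset.sum_sub_distrib, ← Finset.mul_sum, hP1, hP1] at e3
  have e4 : ∑ u, (P x u - κ * P y u) * h (prepend u y) =
      ∑ u, P x u * h (prepend u y) - κ * a := by
    rw [ha', Finset.mul_sum, ← Finset.sum_sub_distrib]
    exact Finset.sum_congr rfl fun u _ => by ring
  linarith

theorem eventually_oscillation_le (hg : ruelle g 1 = 1) (hd : UniformDistortion g)
    (ψ : C(Config d, ℝ)) {δ : ℝ} (hδ : 0 < δ) :
    ∃ N, ∀ n ≥ N, ∀ x y, (ruelle g ^ n) ψ x - (ruelle g ^ n) ψ y ≤ δ := by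
  obtain ⟨κ, hκ, hκ1, hcon⟩ := exists_oscillation_contraction hg hd
  -- With this tolerance `δ / 2` is the fixed point of `r ↦ δκ/2 + (1 - κ) r`, which explains the
  -- bound in `hstep`.
  obtain ⟨p, hp⟩ := hcon ψ (δ * κ / 2) (by positivity)
  have hstep : ∀ k : ℕ, ∀ x y, (ruelle g ^ (k * p)) ψ x - (ruelle g ^ (k * p)) ψ y ≤
      δ / 2 + (1 - κ) ^ k * (2 * ‖ψ‖) := by
    intro k
    induction k with
    | zero =>
      intro x y
      have h1 := (abs_le.1 (ψ.norm_coe_le_norm x)).2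
      have h2 := (abs_le.1 (ψ.norm_coe_le_norm y)).1
      simp only [zero_mul, pow_zero, one_apply_eq_self, one_mul]
      linarith
    | succ k ih =>
      intro x y
      have := hp _ _ ih x y
      rw [show (k + 1) * p = p + k * p by ring]
      refine this.trans (le_of_eq ?_)
      rw [pow_succ]
      ring
  have ht : Tendsto (fun k : ℕ => (1 - κ) ^ k * (2 * ‖ψ‖)) atTop (𝓝 (0 * (2 * ‖ψ‖))) :=
    (tendsto_pow_atTop_nhds_zero_of_lt_one (by linarith) (by linarith)).mul_const _
  rw [zero_mul] at ht
  obtain ⟨k, hk⟩ := (ht.eventually_lt_const (half_pos hδ)).exists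
  refine ⟨k * p, fun n hn x y => ?_⟩
  obtain ⟨m, rfl⟩ := Nat.exists_eq_add_of_le' hn
  rw [ruelle_pow_add_apply, ruelle_pow_add_apply]
  have hb : ∀ z w, (ruelle g ^ (k * p)) ψ z - (ruelle g ^ (k * p)) ψ w ≤ δ := fun z w => by
    linarith [hstep k z w]
  have h1 : ∀ w, (ruelle g ^ m) ((ruelle g ^ (k * p)) ψ) x ≤ (ruelle g ^ (k * p)) ψ w + δ :=
    fun w => ruelle_pow_le_of_le hg (fun z => by linarith [hb z w]) m x
  have := le_ruelle_pow_of_le hg (fun w => sub_le_iff_le_add.2 (h1 w)) m y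
  linarith

/-- Compactness supplies a limit of the finite-volume measures along an ultrafilter. Once `L_gⁿ ψ`
oscillates by at most `ε`, all later iterates, being averages of it, stay within `ε` of each of its
values, and so does the limit. -/
theorem exists_asymptoticState_of_normalized [NeZero d] (hg : ruelle g 1 = 1)
    (hd : UniformDistortion g) : ∃ μ : ProbabilityMeasure (Config d), IsAsymptoticState g μ := by
  let y₀ : Config d := fun _ => 0
  let P := (hyperfilter ℕ).map fun n => gibbs (potentialEnergy g) n y₀
  have hμ : Tendsto (fun n => gibbs (potentialEnergy g) n y₀) (hyperfilter ℕ : Filter ℕ)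
      (𝓝 P.lim) := P.le_nhds_lim
  refine ⟨P.lim, fun ψ ε hε => ?_⟩
  have ht := tendsto_probabilityMeasure_iff.1 hμ ψ
  obtain ⟨N, hN⟩ := eventually_oscillation_le hg hd ψ hε
  refine ⟨N, fun n hn x => ?_⟩
  rw [ruelle_pow_one_of_normalized hg, ContinuousMap.one_apply, mul_one, mul_one]
  have hval : ∀ m, ∫ z, ψ z ∂(gibbs (potentialEnergy g) m y₀ : Measure (Config d)) =
      (ruelle g ^ m) ψ (shift^[m] y₀) := fun m => by
    change ∫ z, ψ z ∂(kernelMeasure (potentialEnergy g) m y₀) = _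
    rw [integral_kernelMeasure_potentialEnergy, ruelle_pow_one_of_normalized hg,
      ContinuousMap.one_apply, div_one]
  have hev : ∀ᶠ m in (hyperfilter ℕ : Filter ℕ), n ≤ m :=
    Nat.hyperfilter_le_atTop (eventually_ge_atTop n)
  have hb : ∀ m, n ≤ m → ∀ z, (ruelle g ^ n) ψ x - ε ≤ (ruelle g ^ m) ψ z ∧
      (ruelle g ^ m) ψ z ≤ (ruelle g ^ n) ψ x + ε := by
    intro m hm z
    obtain ⟨k, rfl⟩ := Nat.exists_eq_add_of_le' hm
    rw [ruelle_pow_add_apply]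
    exact ⟨le_ruelle_pow_of_le hg (fun w => by linarith [hN n hn x w]) k z,
      ruelle_pow_le_of_le hg (fun w => by linarith [hN n hn w x]) k z⟩
  have h1 := ge_of_tendsto ht (hev.mono fun m hm => (hval m).symm ▸ (hb m hm _).1)
  have h2 := le_of_tendsto ht (hev.mono fun m hm => (hval m).symm ▸ (hb m hm _).2)
  rw [abs_le]
  constructor <;> linarith

end Normalized

/-! ### The limit state is fixed by the normalized dual operator and is shift-invariant. -/

theorem IsAsymptoticState.tendsto_ratio [NeZero d] {f : C(Config d, ℝ)}
    {ν : ProbabilityMeasure (Config d)} (h : IsAsymptoticState f ν) (ψ : C(Config d, ℝ))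
    (x : ℕ → Config d) :
    Tendsto (fun n => (ruelle f ^ n) ψ (x n) / (ruelle f ^ n) 1 (x n)) atTop
      (𝓝 (∫ z, ψ z ∂(ν : Measure (Config d)))) := by
  rw [Metric.tendsto_atTop]
  intro ε hε
  obtain ⟨N, hN⟩ := h ψ (ε / 2) (half_pos hε)
  refine ⟨N, fun n hn => ?_⟩
  have hpos := ruelle_pow_one_pos f n (x n)
  rw [Real.dist_eq, div_sub' hpos.ne', abs_div, abs_of_pos hpos, div_lt_iff₀ hpos,
    mul_comm ((ruelle f ^ n) 1 _)]
  exact (hN n hn (x n)).trans_lt (mul_lt_mul_of_pos_right (half_lt_self hε) hpos)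

theorem isFiniteMeasure_ruelleDual (f : C(Config d, ℝ)) (m : Measure (Config d))
    [IsFiniteMeasure m] : IsFiniteMeasure (ruelleDual f m) := by
  constructor
  rw [← lintegral_one, lintegral_ruelleDual _ _ measurable_const]
  refine ENNReal.sum_lt_top.2 fun a _ => ?_
  simp only [mul_one]
  exact (integrable_continuousMap (expCons f a) m).lintegral_lt_top

theorem ruelleDual_eq_smul {f : C(Config d, ℝ)} {m : Measure (Config d)} [IsFiniteMeasure m]
    {c : ℝ} (hc : 0 ≤ c)
    (h : ∀ ψ : C(Config d, ℝ), ∫ x, ruelle f ψ x ∂m = c * ∫ x, ψ x ∂m) :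
    ruelleDual f m = ENNReal.ofReal c • m := by
  have := isFiniteMeasure_ruelleDual f m
  have : IsFiniteMeasure (ENNReal.ofReal c • m) := m.smul_finite ENNReal.ofReal_ne_top
  refine measure_ext_continuousMap fun ψ => ?_
  rw [integral_ruelleDual, h, integral_smul_measure, ENNReal.toReal_ofReal hc, smul_eq_mul]

theorem IsAsymptoticState.integral_ruelle_of_normalized [NeZero d] {g : C(Config d, ℝ)}
    {μ : ProbabilityMeasure (Config d)} (h : IsAsymptoticState g μ) (hg : ruelle g 1 = 1)
    (ψ : C(Config d, ℝ)) :
    ∫ x, ruelle g ψ x ∂(μ : Measure (Config d)) = ∫ x, ψ x ∂(μ : Measure (Config d)) := by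
  let x₀ : Config d := fun _ => 0
  have h1 := h.tendsto_ratio (ruelle g ψ) fun _ => x₀
  have h2 := (h.tendsto_ratio ψ fun _ => x₀).comp (tendsto_add_atTop_nat 1)
  refine tendsto_nhds_unique h1 (h2.congr fun n => ?_)
  simp only [Function.comp, ruelle_pow_one_of_normalized hg, pow_succ, mul_apply_eq_comp, hg]

theorem ruelle_comp_shift {g : C(Config d, ℝ)} (hg : ruelle g 1 = 1) (ψ : C(Config d, ℝ)) :
    ruelle g (ψ.comp ⟨shift, continuous_shift⟩) = ψ := by
  ext x
  have := congrArg (fun χ : C(Config d, ℝ) => χ x) hg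
  simp only [ruelle_apply, ContinuousMap.one_apply, mul_one] at this
  simp only [ruelle_apply, ContinuousMap.comp_apply, ContinuousMap.coe_mk, shift_cons]
  rw [← Finset.sum_mul, this, one_mul]

theorem mem_invariantMeasures_iff {m : ProbabilityMeasure (Config d)} :
    m ∈ invariantMeasures d ↔ ∀ ψ : C(Config d, ℝ),
      ∫ x, ψ (shift x) ∂(m : Measure (Config d)) = ∫ x, ψ x ∂(m : Measure (Config d)) := by
  have hs : Measurable (shift : Config d → Config d) := continuous_shift.measurable
  have hmap : ∀ ψ : C(Config d, ℝ), ∫ x, ψ x ∂((m : Measure (Config d)).map shift) =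
      ∫ x, ψ (shift x) ∂(m : Measure (Config d)) := fun ψ =>
    integral_map hs.aemeasurable ψ.continuous.aestronglyMeasurable
  constructor
  · intro h ψ
    rw [← hmap, h.map_eq]
  · intro h
    refine ⟨hs, ?_⟩
    have := Measure.isFiniteMeasure_map (m : Measure (Config d)) (shift : Config d → Config d)
    exact measure_ext_continuousMap fun ψ => by rw [hmap, h]

/-- Invariance follows from `L_g^* μ = μ` tested on `ψ ∘ σ`, because `L_g (ψ ∘ σ) = ψ`. -/
theorem IsAsymptoticState.mem_invariantMeasures [NeZero d] {g : C(Config d, ℝ)}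
    {μ : ProbabilityMeasure (Config d)} (h : IsAsymptoticState g μ) (hg : ruelle g 1 = 1) :
    μ ∈ invariantMeasures d := by
  rw [mem_invariantMeasures_iff]
  intro ψ
  have := h.integral_ruelle_of_normalized hg (ψ.comp ⟨shift, continuous_shift⟩)
  rw [ruelle_comp_shift hg] at this
  exact this.symm

/-! ### From the normalization to the potential -/

theorem abs_pow_le_of_mem_spectrum {E : Type*} [NormedAddCommGroup E] [NormedSpace ℝ E]
    [CompleteSpace E] [Nontrivial E] (T : E →L[ℝ] E) {k : ℝ} (hk : k ∈ spectrum ℝ T) (n : ℕ) :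
    |k| ^ n ≤ ‖T ^ n‖ := by
  have h1 := spectrum.pow_mem_pow T n hk
  have h2 := spectrum.norm_le_norm_of_mem h1
  rwa [norm_pow, Real.norm_eq_abs] at h2

/-- The function `ψ / φ`. -/
noncomputable def divPos (ψ φ : C(Config d, ℝ)) (hφ : ∀ x, 0 < φ x) : C(Config d, ℝ) :=
  ⟨fun x => ψ x / φ x, ψ.continuous.div φ.continuous fun x => (hφ x).ne'⟩

/-- The function `log φ`. -/
noncomputable def logPos (φ : C(Config d, ℝ)) (hφ : ∀ x, 0 < φ x) : C(Config d, ℝ) :=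
  ⟨fun x => Real.log (φ x), φ.continuous.log fun x => (hφ x).ne'⟩

theorem exists_isNormalization [NeZero d] {f : C(Config d, ℝ)} (hf : UniformDistortion f) :
    ∃ (g φ : C(Config d, ℝ)) (l : ℝ), IsNormalization f φ l g := by
  obtain ⟨φ, l, hφ, hl, he⟩ := exists_eigenfunction hf
  exact ⟨f + logPos φ hφ - (logPos φ hφ).comp ⟨shift, continuous_shift⟩ -
    ContinuousMap.const _ (Real.log l), φ, l, hφ, hl, he, fun x => rfl⟩

namespace IsNormalization

variable {f φ g : C(Config d, ℝ)} {l : ℝ}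

theorem uniformDistortion (h : IsNormalization f φ l g) (hf : UniformDistortion f) :
    UniformDistortion g :=
  hf.coboundary (logPos φ h.eigenfunction_pos) h.eq

/-- The coboundary telescopes along the orbit: only `log φ` at the two ends survives, and the end
`σⁿ(ux) = x` does not depend on the word. -/
theorem ruelle_pow (h : IsNormalization f φ l g) (ψ : C(Config d, ℝ)) (n : ℕ) (x : Config d) :
    (ruelle f ^ n) ψ x =
      l ^ n * φ x * (ruelle g ^ n) (divPos ψ φ h.eigenfunction_pos) x := by
  rw [ruelle_pow_apply, ruelle_pow_apply, Finset.mul_sum]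
  refine Finset.sum_congr rfl fun u _ => ?_
  have hx := h.eigenfunction_pos x
  have hu := h.eigenfunction_pos (prepend u x)
  rw [birkhoffSum_coboundary (h := fun z => Real.log (φ z)) h.eq, shift_iterate_prepend,
    Real.exp_sub, Real.exp_sub, Real.exp_add, Real.exp_log hx, Real.exp_log hu,
    Real.exp_nat_mul, Real.exp_log h.eigenvalue_pos]
  have hl := (pow_pos h.eigenvalue_pos n).ne'
  simp only [divPos, ContinuousMap.coe_mk]
  field_simp

theorem divPos_self (hφ : ∀ x, 0 < φ x) : divPos φ φ hφ = 1 := by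
  ext x
  exact div_self (hφ x).ne'

theorem ruelle_one (h : IsNormalization f φ l g) : ruelle g 1 = 1 := by
  ext x
  have h1 := h.ruelle_pow φ 1 x
  rw [divPos_self, pow_one, pow_one, pow_one, h.eigen, ContinuousMap.smul_apply,
    smul_eq_mul] at h1
  have h2 : l * φ x ≠ 0 := (mul_pos h.eigenvalue_pos (h.eigenfunction_pos x)).ne'
  rw [ContinuousMap.one_apply]
  exact mul_left_cancel₀ h2 (by linarith)

/-- This uniform lower bound turns absolute errors for `g` into errors relative to `L_fⁿ 1 = lⁿ φ
L_gⁿ(1/φ)`. -/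
theorem inv_norm_le [NeZero d] (h : IsNormalization f φ l g) :
    0 < ‖φ‖ ∧ ∀ n x, ‖φ‖⁻¹ ≤ (ruelle g ^ n) (divPos 1 φ h.eigenfunction_pos) x := by
  have hle : ∀ x, φ x ≤ ‖φ‖ := fun x => (le_abs_self _).trans (φ.norm_coe_le_norm x)
  refine ⟨(h.eigenfunction_pos fun _ => 0).trans_le (hle _), fun n x => ?_⟩
  refine le_ruelle_pow_of_le h.ruelle_one (fun z => ?_) n x
  simp only [divPos, ContinuousMap.coe_mk, ContinuousMap.one_apply, one_div]
  exact inv_anti₀ (h.eigenfunction_pos z) (hle z)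

theorem tendsto_ruelle_pow [NeZero d] (h : IsNormalization f φ l g)
    {μ : ProbabilityMeasure (Config d)} (hμ : IsAsymptoticState g μ) (ψ : C(Config d, ℝ))
    (x : ℕ → Config d) :
    Tendsto (fun n => (ruelle g ^ n) ψ (x n)) atTop (𝓝 (∫ z, ψ z ∂(μ : Measure (Config d)))) := by
  have := hμ.tendsto_ratio ψ x
  simpa only [ruelle_pow_one_of_normalized h.ruelle_one, ContinuousMap.one_apply, div_one] using this

theorem integral_inv_pos [NeZero d] (h : IsNormalization f φ l g)
    (μ : ProbabilityMeasure (Config d)) :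
    0 < ∫ z, divPos 1 φ h.eigenfunction_pos z ∂(μ : Measure (Config d)) := by
  obtain ⟨hn, hle⟩ := h.inv_norm_le
  have h1 : ∫ _, ‖φ‖⁻¹ ∂(μ : Measure (Config d)) ≤
      ∫ z, divPos 1 φ h.eigenfunction_pos z ∂(μ : Measure (Config d)) :=
    integral_mono (integrable_const _) (integrable_continuousMap _ _) fun z => by
      simpa using hle 0 z
  simp only [integral_const, probReal_univ, one_smul] at h1
  exact (inv_pos.2 hn).trans_le h1

/-- Dividing the conjugation formulas for `ψ` and `1` identifies the limit as `∫ ψ dν = ∫ (ψ/φ) dμ /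
∫ (1/φ) dμ`. Compactness is used only to have a probability measure realizing this functional. -/
theorem exists_eigenmeasure [NeZero d] (h : IsNormalization f φ l g)
    {μ : ProbabilityMeasure (Config d)} (hμ : IsAsymptoticState g μ) :
    ∃ ν : ProbabilityMeasure (Config d), IsAsymptoticState f ν ∧
      ruelleDual f (ν : Measure (Config d)) = ENNReal.ofReal l • (ν : Measure (Config d)) := by
  have hφ := h.eigenfunction_pos
  let y₀ : Config d := fun _ => 0
  let P := (hyperfilter ℕ).map fun n => gibbs (potentialEnergy f) n y₀
  have hlim : Tendsto (fun n => gibbs (potentialEnergy f) n y₀) (hyperfilter ℕ : Filter ℕ)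
      (𝓝 P.lim) := P.le_nhds_lim
  set ν := P.lim
  set K := ∫ z, divPos 1 φ hφ z ∂(μ : Measure (Config d)) with hK
  have hKpos : 0 < K := h.integral_inv_pos μ
  have hν : ∀ ψ : C(Config d, ℝ), ∫ z, ψ z ∂(ν : Measure (Config d)) =
      (∫ z, divPos ψ φ hφ z ∂(μ : Measure (Config d))) / K := by
    intro ψ
    refine tendsto_nhds_unique (tendsto_probabilityMeasure_iff.1 hlim ψ) ?_
    have h1 := (h.tendsto_ruelle_pow hμ (divPos ψ φ hφ) fun n => shift^[n] y₀).div
      (h.tendsto_ruelle_pow hμ (divPos 1 φ hφ) fun n => shift^[n] y₀) hKpos.ne'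
    refine (h1.mono_left Nat.hyperfilter_le_atTop).congr fun n => ?_
    change _ = ∫ z, ψ z ∂(kernelMeasure (potentialEnergy f) n y₀)
    rw [integral_kernelMeasure_potentialEnergy, h.ruelle_pow, h.ruelle_pow 1,
      mul_div_mul_left _ _ (mul_pos (pow_pos h.eigenvalue_pos n) (hφ _)).ne']
    rfl
  refine ⟨ν, fun ψ ε hε => ?_, ?_⟩
  · set I := ∫ z, ψ z ∂(ν : Measure (Config d)) with hI
    obtain ⟨hn, hle⟩ := h.inv_norm_le
    -- This combination has `μ`-integral zero by the formula for `ν`, so its iterates tend uniformly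
    -- to zero.
    obtain ⟨N, hN⟩ := hμ (divPos ψ φ hφ - I • divPos 1 φ hφ) (ε * ‖φ‖⁻¹) (by positivity)
    refine ⟨N, fun n hn x => ?_⟩
    have h0 : ∫ z, (divPos ψ φ hφ - I • divPos 1 φ hφ) z ∂(μ : Measure (Config d)) = 0 := by
      simp only [ContinuousMap.sub_apply, ContinuousMap.smul_apply, smul_eq_mul]
      rw [integral_sub (integrable_continuousMap _ _)
        ((integrable_continuousMap _ _).const_mul _), integral_const_mul, ← hK, hI, hν,
        div_mul_cancel₀ _ hKpos.ne', sub_self]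
    have h1 := hN n hn x
    rw [h0, ruelle_pow_one_of_normalized h.ruelle_one, zero_mul, sub_zero,
      ContinuousMap.one_apply, mul_one, map_sub, map_smul, ContinuousMap.sub_apply,
      ContinuousMap.smul_apply, smul_eq_mul] at h1
    have hc : 0 < l ^ n * φ x := mul_pos (pow_pos h.eigenvalue_pos n) (hφ x)
    rw [h.ruelle_pow, h.ruelle_pow 1, mul_left_comm I, ← mul_sub, abs_mul, abs_of_pos hc,
      mul_left_comm ε]
    refine mul_le_mul_of_nonneg_left (h1.trans ?_) hc.le
    exact mul_le_mul_of_nonneg_left (hle n x) hε.le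
  · refine ruelleDual_eq_smul h.eigenvalue_pos.le fun ψ => ?_
    have h1 : divPos (ruelle f ψ) φ hφ = l • ruelle g (divPos ψ φ hφ) := by
      ext x
      have := h.ruelle_pow ψ 1 x
      simp only [pow_one] at this
      simp only [divPos, ContinuousMap.coe_mk, ContinuousMap.smul_apply, smul_eq_mul] at this ⊢
      rw [this]
      have := (hφ x).ne'
      field_simp
    rw [hν, hν, h1]
    simp only [ContinuousMap.smul_apply, smul_eq_mul]
    rw [integral_const_mul, hμ.integral_ruelle_of_normalized h.ruelle_one]
    ring

theorem norm_ruelle_pow_le [NeZero d] (h : IsNormalization f φ l g) :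
    ∃ B : ℝ, ∀ n, ‖ruelle f ^ n‖ ≤ l ^ n * B := by
  have hφ := h.eigenfunction_pos
  have hl := h.eigenvalue_pos
  refine ⟨‖φ‖ * ‖divPos 1 φ hφ‖, fun n => ?_⟩
  refine ContinuousLinearMap.opNorm_le_bound _ (by positivity) fun ψ => ?_
  rw [ContinuousMap.norm_le _ (by positivity)]
  intro x
  have hb : ∀ z, |divPos ψ φ hφ z| ≤ ‖divPos 1 φ hφ‖ * ‖ψ‖ := fun z => by
    have h1 : divPos ψ φ hφ z = divPos 1 φ hφ z * ψ z := by
      simp only [divPos, ContinuousMap.coe_mk, ContinuousMap.one_apply]; ring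
    rw [h1, abs_mul]
    exact mul_le_mul ((divPos 1 φ hφ).norm_coe_le_norm z) (ψ.norm_coe_le_norm z) (abs_nonneg _)
      (norm_nonneg _)
  have h1 : |(ruelle g ^ n) (divPos ψ φ hφ) x| ≤ ‖divPos 1 φ hφ‖ * ‖ψ‖ := abs_le.2
    ⟨le_ruelle_pow_of_le h.ruelle_one (fun z => (abs_le.1 (hb z)).1) n x,
      ruelle_pow_le_of_le h.ruelle_one (fun z => (abs_le.1 (hb z)).2) n x⟩
  have h2 : φ x ≤ ‖φ‖ := (le_abs_self _).trans (φ.norm_coe_le_norm x)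
  rw [h.ruelle_pow, Real.norm_eq_abs, abs_mul, abs_mul, abs_of_pos (hφ x),
    abs_of_pos (pow_pos hl n)]
  calc l ^ n * φ x * |(ruelle g ^ n) (divPos ψ φ hφ) x|
      ≤ l ^ n * ‖φ‖ * (‖divPos 1 φ hφ‖ * ‖ψ‖) := by gcongr
    _ = l ^ n * (‖φ‖ * ‖divPos 1 φ hφ‖) * ‖ψ‖ := by ring

/-- A spectral value `k` satisfies `|k|ⁿ ≤ ‖L_fⁿ‖ ≤ lⁿ B` for all `n`, hence `|k| ≤ l`; and `l` lies
in the spectrum because `φ` is an eigenvector. -/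
theorem spectralRadius_eq [NeZero d] (h : IsNormalization f φ l g) :
    spectralRadius ℝ (ruelle f) = ENNReal.ofReal l := by
  have hl := h.eigenvalue_pos
  apply le_antisymm
  · obtain ⟨B, hB⟩ := h.norm_ruelle_pow_le
    have : Nontrivial C(Config d, ℝ) := ⟨1, 0, fun h0 => by
      simpa using congrArg (fun ψ : C(Config d, ℝ) => ψ fun _ => 0) h0⟩
    refine iSup₂_le fun k hk => ?_
    have hpow : ∀ n : ℕ, |k| ^ n ≤ l ^ n * B := fun n => by
      exact (abs_pow_le_of_mem_spectrum (ruelle f) hk n).trans (hB n)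
    have hk' : |k| ≤ l := by
      by_contra hlt
      push Not at hlt
      have h3 : 1 < |k| / l := by rwa [one_lt_div hl]
      obtain ⟨n, hn⟩ := pow_unbounded_of_one_lt B h3
      have := hpow n
      rw [div_pow, lt_div_iff₀ (pow_pos hl n)] at hn
      linarith
    rw [← enorm_eq_nnnorm, Real.enorm_eq_ofReal_abs]
    exact ENNReal.ofReal_le_ofReal hk'
  · have hmem : l ∈ spectrum ℝ (ruelle f) := by
      rw [spectrum.mem_iff]
      rintro ⟨u, hu⟩
      have h0 : (u : C(Config d, ℝ) →L[ℝ] C(Config d, ℝ)) φ = 0 := by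
        rw [hu, sub_apply, h.eigen, Algebra.algebraMap_eq_smul_one]
        simp
      have h1 : φ = 0 := by
        have h2 : ((u⁻¹ : (C(Config d, ℝ) →L[ℝ] C(Config d, ℝ))ˣ) *
            (u : C(Config d, ℝ) →L[ℝ] C(Config d, ℝ))) φ = φ := by
          rw [Units.inv_mul]; rfl
        rwa [mul_apply_eq_comp, h0, map_zero, eq_comm] at h2
      have h2 := h.eigenfunction_pos fun _ => 0
      rw [h1] at h2
      exact lt_irrefl _ h2
    have := le_iSup₂ (f := fun (k : ℝ) (_ : k ∈ spectrum ℝ (ruelle f)) => (‖k‖₊ : ℝ≥0∞)) l hmem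
    refine le_trans (le_of_eq ?_) this
    rw [← enorm_eq_nnnorm, Real.enorm_eq_ofReal hl.le]

/-- The spectral radius fixes the eigenvalue. Then `φ'/φ` is invariant under `L_g`, whose iterates
converge to constants, so `φ'` is a multiple of `φ` and the factor cancels in the coboundary. -/
theorem unique [NeZero d] (h : IsNormalization f φ l g) (hf : UniformDistortion f)
    {φ' g' : C(Config d, ℝ)} {l' : ℝ} (h' : IsNormalization f φ' l' g') : g' = g := by
  have hll : l' = l := by
    have := h.spectralRadius_eq.symm.trans h'.spectralRadius_eq
    exact ((ENNReal.ofReal_eq_ofReal_iff h.eigenvalue_pos.le h'.eigenvalue_pos.le).1 this).symm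
  subst hll
  obtain ⟨μ, hμ⟩ := exists_asymptoticState_of_normalized h.ruelle_one (h.uniformDistortion hf)
  set c := ∫ z, divPos φ' φ h.eigenfunction_pos z ∂(μ : Measure (Config d))
  have heig : ∀ n, (ruelle f ^ n) φ' = l' ^ n • φ' := fun n => by
    induction n with
    | zero => simp
    | succ n ih => rw [pow_succ', mul_apply_eq_comp, ih, map_smul, h'.eigen, smul_smul, pow_succ]
  have hφ' : ∀ x, φ' x = φ x * c := fun x => by
    have h1 := (h.tendsto_ruelle_pow hμ (divPos φ' φ h.eigenfunction_pos) fun _ => x).const_mul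
      (φ x)
    refine (tendsto_nhds_unique h1 (tendsto_const_nhds.congr fun n => ?_)).symm
    have h2 := h.ruelle_pow φ' n x
    rw [heig, ContinuousMap.smul_apply, smul_eq_mul, mul_assoc] at h2
    exact mul_left_cancel₀ (pow_pos h.eigenvalue_pos n).ne' h2
  have hc : c ≠ 0 := fun hc => by
    have h1 := h'.eigenfunction_pos fun _ => 0
    rw [hφ', hc, mul_zero] at h1
    exact lt_irrefl _ h1
  ext x
  rw [h'.eq, h.eq, hφ', hφ' (shift x), Real.log_mul (h.eigenfunction_pos _).ne' hc,
    Real.log_mul (h.eigenfunction_pos _).ne' hc]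
  ring

end IsNormalization

/-! ### Entropy estimates -/

section Entropy

variable {X : Type*} [MeasurableSpace X]

/-- Gibbs' inequality, from `log t ≤ t - 1` at `t = q/p`; terms with `p = 0` are treated separately.
-/
theorem sum_negMulLog_le {ι : Type*} [Fintype ι] {p q : ι → ℝ} (hp : ∀ i, 0 ≤ p i)
    (hq : ∀ i, 0 < q i) (h : ∑ i, q i ≤ ∑ i, p i) :
    ∑ i, Real.negMulLog (p i) ≤ ∑ i, p i * -Real.log (q i) := by
  have key : ∀ i, Real.negMulLog (p i) - p i * -Real.log (q i) ≤ q i - p i := by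
    intro i
    rcases (hp i).eq_or_lt with h0 | h0
    · rw [← h0]; simpa using (hq i).le
    · have h1 := Real.log_le_sub_one_of_pos (div_pos (hq i) h0)
      rw [Real.log_div (hq i).ne' h0.ne'] at h1
      have h2 := mul_le_mul_of_nonneg_left h1 h0.le
      rw [mul_sub, mul_sub, mul_div_cancel₀ _ h0.ne'] at h2
      rw [Real.negMulLog]
      linarith
  have := Finset.sum_le_sum fun i (_ : i ∈ Finset.univ) => key i
  rw [Finset.sum_sub_distrib, Finset.sum_sub_distrib] at this
  linarith

/-- The `π`-name of length `n` of the orbit of `x`. -/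
def orbitName (T : X → X) {k : ℕ} (π : X → Fin k) (n : ℕ) (x : X) : Fin n → Fin k :=
  fun i => π (T^[i] x)

theorem measurable_orbitName {T : X → X} (hT : Measurable T) {k : ℕ} {π : X → Fin k}
    (hπ : Measurable π) (n : ℕ) : Measurable (orbitName T π n) :=
  measurable_pi_lambda _ fun i => hπ.comp (hT.iterate i)

theorem joinEntropy_eq (T : X → X) (μ : Measure X) {k : ℕ} (π : X → Fin k) (n : ℕ) :
    joinEntropy T μ π n = ∑ w, Real.negMulLog (μ.real (orbitName T π n ⁻¹' {w})) := by
  unfold joinEntropy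
  refine Finset.sum_congr rfl fun w _ => ?_
  congr 2
  ext x
  exact funext_iff.symm

theorem integral_comp_fintype {ι : Type*} [Fintype ι] [MeasurableSpace ι]
    [MeasurableSingletonClass ι] (μ : Measure X) [IsFiniteMeasure μ] {W : X → ι}
    (hW : Measurable W) (F : ι → ℝ) :
    Integrable (fun x => F (W x)) μ ∧ ∫ x, F (W x) ∂μ = ∑ w, μ.real (W ⁻¹' {w}) * F w := by
  have hF : Measurable F := measurable_of_finite F
  have hfin := Measure.isFiniteMeasure_map μ W
  have hint : Integrable F (μ.map W) := Integrable.of_finite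
  refine ⟨hint.comp_measurable hW, ?_⟩
  rw [← integral_map hW.aemeasurable hF.aestronglyMeasurable, integral_fintype hint]
  refine Finset.sum_congr rfl fun w _ => ?_
  rw [map_measureReal_apply hW (measurableSet_singleton w), smul_eq_mul]

/-- Any strictly positive sub-probability `q` on names bounds the entropy from above by the mean of
`-log q`; the upper bound on entropy reduces to choosing `q` well. -/
theorem joinEntropy_le_integral {T : X → X} (hT : Measurable T) (μ : Measure X)
    [IsProbabilityMeasure μ] {k : ℕ} {π : X → Fin k} (hπ : Measurable π) {n : ℕ}
    {q : (Fin n → Fin k) → ℝ} (hq : ∀ w, 0 < q w) (hq1 : ∑ w, q w ≤ 1) {h : X → ℝ}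
    (hh : Integrable h μ) (hle : ∀ x, -Real.log (q (orbitName T π n x)) ≤ h x) :
    joinEntropy T μ π n ≤ ∫ x, h x ∂μ := by
  have hW := measurable_orbitName hT hπ n
  have hsum : ∑ w, μ.real (orbitName T π n ⁻¹' {w}) = 1 := by
    have := (integral_comp_fintype μ hW fun _ => (1 : ℝ)).2
    simpa using this.symm
  obtain ⟨hi, he⟩ := integral_comp_fintype μ hW fun w => -Real.log (q w)
  rw [joinEntropy_eq]
  refine (sum_negMulLog_le (fun _ => measureReal_nonneg) hq (hq1.trans hsum.ge)).trans ?_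
  rw [← he]
  exact integral_mono hi hh hle

theorem limsup_div_le {J : ℕ → ℝ} {a K : ℝ} (h : ∀ n : ℕ, J n ≤ n * a + K) :
    limsup (fun n : ℕ => ((J n / n : ℝ) : EReal)) atTop ≤ (a : EReal) := by
  have ht : Tendsto (fun n : ℕ => ((a + K / n : ℝ) : EReal)) atTop (𝓝 (a : EReal)) := by
    have := (tendsto_const_div_atTop_nhds_zero_nat K).const_add a
    rw [add_zero] at this
    exact (continuous_coe_real_ereal.tendsto _).comp this
  rw [← ht.limsup_eq]
  refine limsup_le_limsup ?_
  filter_upwards [eventually_gt_atTop 0] with n hn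
  have hn' : (0 : ℝ) < n := by exact_mod_cast hn
  rw [EReal.coe_le_coe_iff, div_le_iff₀ hn', add_mul, div_mul_cancel₀ _ hn'.ne']
  linarith [h n]

theorem le_limsup_div {J : ℕ → ℝ} {a K : ℝ} (h : ∀ n : ℕ, n * a - K ≤ J n) :
    (a : EReal) ≤ limsup (fun n : ℕ => ((J n / n : ℝ) : EReal)) atTop := by
  have ht : Tendsto (fun n : ℕ => ((a - K / n : ℝ) : EReal)) atTop (𝓝 (a : EReal)) := by
    have := (tendsto_const_div_atTop_nhds_zero_nat K).const_sub a
    rw [sub_zero] at this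
    exact (continuous_coe_real_ereal.tendsto _).comp this
  rw [← ht.limsup_eq]
  refine limsup_le_limsup ?_
  filter_upwards [eventually_gt_atTop 0] with n hn
  have hn' : (0 : ℝ) < n := by exact_mod_cast hn
  rw [EReal.coe_le_coe_iff, le_div_iff₀ hn', sub_mul, div_mul_cancel₀ _ hn'.ne']
  linarith [h n]

theorem ereal_le_of_forall_pos_le_add {x : EReal} {a : ℝ}
    (h : ∀ η : ℝ, 0 < η → x ≤ ((a + η : ℝ) : EReal)) : x ≤ (a : EReal) := by
  by_contra hlt
  obtain ⟨z, hz1, hz2⟩ := EReal.lt_iff_exists_real_btwn.1 (not_le.1 hlt)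
  have h1 := h (z - a) (sub_pos.2 (EReal.coe_lt_coe_iff.1 hz1))
  rw [add_sub_cancel] at h1
  exact absurd h1 (not_le.2 hz2)

end Entropy

/-! ### The entropy inequality for normalized potentials on the shift. -/

/-- Continuity alone suffices at this precision: all but the last `p` terms differ by at most `ε`.
This matters because the perturbed potentials in the uniqueness argument are only known to be
continuous. -/
theorem exists_birkhoffSum_variation_le (g : C(Config d, ℝ)) {ε : ℝ} (hε : 0 < ε) :
    ∃ K : ℝ, 0 ≤ K ∧ ∀ (n : ℕ) (x y : Config d), (∀ i < n, x i = y i) →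
      |birkhoffSum shift g n x - birkhoffSum shift g n y| ≤ n * ε + K := by
  obtain ⟨p, hp⟩ := exists_abs_sub_le_of_agree g hε
  have hg0 := norm_nonneg g
  refine ⟨p * (2 * ‖g‖), by positivity, fun n x y hxy => ?_⟩
  have hterm : ∀ i ∈ Finset.range n, |g (shift^[i] x) - g (shift^[i] y)| ≤
      ε + if i ∈ Finset.Ico (n - p) n then 2 * ‖g‖ else 0 := by
    intro i hi
    rw [Finset.mem_range] at hi
    split_ifs with h
    · have h1 := abs_le.1 (g.norm_coe_le_norm (shift^[i] x))
      have h2 := abs_le.1 (g.norm_coe_le_norm (shift^[i] y))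
      rw [abs_le]
      constructor <;> linarith [h1.1, h1.2, h2.1, h2.2]
    · rw [add_zero]
      refine hp _ _ (shift_iterate_agree fun j hj => hxy j ?_)
      rw [Finset.mem_Ico] at h
      omega
  rw [birkhoffSum, birkhoffSum, ← Finset.sum_sub_distrib]
  refine (Finset.abs_sum_le_sum_abs _ _).trans ((Finset.sum_le_sum hterm).trans ?_)
  rw [Finset.sum_add_distrib, Finset.sum_const, Finset.card_range, nsmul_eq_mul,
    ← Finset.sum_filter, Finset.sum_const, nsmul_eq_mul]
  gcongr
  refine (Finset.card_le_card (t := Finset.Ico (n - p) n) fun i hi =>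
    (Finset.mem_filter.1 hi).2).trans ?_
  rw [Nat.card_Ico]
  omega

theorem integral_comp_shift_iterate {m : ProbabilityMeasure (Config d)}
    (hm : m ∈ invariantMeasures d) {h : Config d → ℝ} (hh : Measurable h) (n : ℕ) :
    ∫ x, h (shift^[n] x) ∂(m : Measure (Config d)) = ∫ x, h x ∂(m : Measure (Config d)) := by
  have hmp := (show MeasurePreserving shift (m : Measure (Config d)) m from hm).iterate n
  rw [← integral_map hmp.measurable.aemeasurable hh.aestronglyMeasurable, hmp.map_eq]

theorem integral_birkhoffSum {m : ProbabilityMeasure (Config d)}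
    (hm : m ∈ invariantMeasures d) {h : Config d → ℝ} (hh : Measurable h)
    (hi : Integrable h (m : Measure (Config d))) (n : ℕ) :
    Integrable (fun x => birkhoffSum shift h n x) (m : Measure (Config d)) ∧
    ∫ x, birkhoffSum shift h n x ∂(m : Measure (Config d)) =
      n * ∫ x, h x ∂(m : Measure (Config d)) := by
  have hint : ∀ i, Integrable (fun x => h (shift^[i] x)) (m : Measure (Config d)) := fun i =>
    ((show MeasurePreserving shift (m : Measure (Config d)) m from hm).iterate
      i).integrable_comp_of_integrable hi
  unfold birkhoffSum
  refine ⟨integrable_finsetSum _ fun i _ => hint i, ?_⟩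
  rw [integral_finsetSum _ fun i _ => hint i]
  simp [integral_comp_shift_iterate hm hh]

theorem agree_prepend_coords {n : ℕ} (x y : Config d) :
    ∀ i < n, x i = prepend (fun j : Fin n => x j) y i := fun i hi => by
  rw [prepend_lt _ _ hi]

/-- The test distribution on `π`-names draws a word with the weights of `g`, reads off its
`π'`-name, and passes each letter through the noisy channel `P`. Its value at the name of `x` is at
least the contribution of the word of `x` itself, whose cost is `-S g` plus the channel cost at each
time. -/
theorem exists_joinEntropy_le [NeZero d] {g : C(Config d, ℝ)} (hg : ruelle g 1 = 1)
    {m : ProbabilityMeasure (Config d)} (hm : m ∈ invariantMeasures d) {k : ℕ}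
    {π π' : Config d → Fin k} (hπ : Measurable π) (hπ' : Measurable π') {r : ℕ}
    (hr : ∀ x y : Config d, (∀ i < r, x i = y i) → π' x = π' y)
    {P : Fin k → Fin k → ℝ} (hP0 : ∀ a c, 0 < P a c) (hP1 : ∀ c, ∑ a, P a c = 1)
    {ε : ℝ} (hε : 0 < ε) :
    ∃ K : ℝ, ∀ n : ℕ, joinEntropy shift (m : Measure (Config d)) π n ≤
      n * (-(∫ x, g x ∂(m : Measure (Config d))) + ε +
        ∫ x, -Real.log (P (π x) (π' x)) ∂(m : Measure (Config d))) + K := by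
  obtain ⟨K, hK0, hK⟩ := exists_birkhoffSum_variation_le g hε
  let x₀ : Config d := fun _ => 0
  have hs : Measurable (shift : Config d → Config d) := continuous_shift.measurable
  set e : Config d → ℝ := fun x => -Real.log (P (π x) (π' x)) with he
  have hem : Measurable e :=
    (measurable_of_finite fun a : Fin k × Fin k => -Real.log (P a.1 a.2)).comp (hπ.prodMk hπ')
  have hei : Integrable e (m : Measure (Config d)) :=
    (integral_comp_fintype (m : Measure (Config d)) (hπ.prodMk hπ')
      fun a : Fin k × Fin k => -Real.log (P a.1 a.2)).1
  set I := ∫ x, g x ∂(m : Measure (Config d))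
  refine ⟨r * (-I + ε) + K, fun n => ?_⟩
  -- Words have length `n + r` because the `π'`-letter at a time `i < n` depends on coordinates
  -- below `i + r`.
  let c : (Fin (n + r) → Fin d) → ℕ → Fin k := fun u i => π' (shift^[i] (prepend u x₀))
  let q : (Fin n → Fin k) → ℝ := fun w => ∑ u : Fin (n + r) → Fin d,
    Real.exp (birkhoffSum shift g (n + r) (prepend u x₀)) * ∏ i : Fin n, P (w i) (c u i)
  have hterm : ∀ (w : Fin n → Fin k) (u : Fin (n + r) → Fin d), 0 < Real.exp (birkhoffSum shift g (n + r) (prepend u x₀)) *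
      ∏ i : Fin n, P (w i) (c u i) := fun w u =>
    mul_pos (Real.exp_pos _) (Finset.prod_pos fun i _ => hP0 _ _)
  have hq0 : ∀ w, 0 < q w := fun w =>
    Finset.sum_pos (fun u _ => hterm w u) ⟨fun _ => 0, Finset.mem_univ _⟩
  have hq1 : ∑ w, q w = 1 := by
    have hprod : ∀ u, ∑ w : Fin n → Fin k, ∏ i : Fin n, P (w i) (c u i) = 1 := fun u => by
      have := Finset.sum_prod_piFinset (Finset.univ : Finset (Fin k))
        (fun (i : Fin n) a => P a (c u i))
      rw [Fintype.piFinset_univ] at this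
      rw [this]
      exact Finset.prod_eq_one fun i _ => hP1 _
    rw [Finset.sum_comm]
    simp only [← Finset.mul_sum, hprod, mul_one]
    exact sum_exp_birkhoffSum_of_normalized hg _ _
  have hi1 := integral_birkhoffSum hm g.continuous.measurable (integrable_continuousMap g _) (n + r)
  have hi2 := integral_birkhoffSum hm hem hei n
  refine (joinEntropy_le_integral hs (m : Measure (Config d)) hπ hq0 hq1.le
    (h := fun x => -birkhoffSum shift g (n + r) x + (((n + r : ℕ) : ℝ) * ε + K) +
      birkhoffSum shift e n x)
    ((hi1.1.neg.add (integrable_const _)).add hi2.1) fun x => ?_).trans (le_of_eq ?_)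
  · let u : Fin (n + r) → Fin d := fun i => x i
    have hag : ∀ i < n + r, x i = prepend u x₀ i := agree_prepend_coords x x₀
    have hle : Real.exp (birkhoffSum shift g (n + r) (prepend u x₀)) *
        ∏ i : Fin n, P (orbitName shift π n x i) (c u i) ≤ q (orbitName shift π n x) :=
      Finset.single_le_sum (f := fun u => Real.exp (birkhoffSum shift g (n + r) (prepend u x₀)) *
        ∏ i : Fin n, P (orbitName shift π n x i) (c u i))
        (fun u _ => (hterm _ u).le) (Finset.mem_univ u)
    have h1 := Real.log_le_log (hterm _ u) hle
    rw [Real.log_mul (Real.exp_pos _).ne' (Finset.prod_pos fun i _ => hP0 _ _).ne', Real.log_exp,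
      Real.log_prod fun i _ => (hP0 _ _).ne'] at h1
    have h2 : ∑ i : Fin n, Real.log (P (orbitName shift π n x i) (c u i)) =
        -birkhoffSum shift e n x := by
      rw [birkhoffSum, ← Fin.sum_univ_eq_sum_range (fun i => e (shift^[i] x)),
        ← Finset.sum_neg_distrib]
      refine Finset.sum_congr rfl fun i _ => ?_
      have : c u i = π' (shift^[i] x) := (hr _ _ (shift_iterate_agree fun j hj =>
        hag j (by have := i.2; omega))).symm
      rw [this, he, neg_neg]
      rfl
    have h3 := abs_le.1 (hK (n + r) x (prepend u x₀) hag)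
    linarith [h3.2]
  · have hn : Integrable (fun x => -birkhoffSum shift g (n + r) x) (m : Measure (Config d)) :=
      hi1.1.neg
    have hc : Integrable (fun x => -birkhoffSum shift g (n + r) x +
        (((n + r : ℕ) : ℝ) * ε + K)) (m : Measure (Config d)) := hn.add (integrable_const _)
    rw [integral_add hc hi2.1, integral_add hn (integrable_const _), integral_neg, hi1.2, hi2.2]
    simp only [integral_const, probReal_univ, one_smul]
    push_cast
    ring

/-- Each cell of `π` is approximated by a cylinder set `C j` up to `ε / k`, and `π'` selects an
index `j` with `x ∈ C j`. A point where `π` and `π'` differ lies in one of the symmetric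
differences. -/
theorem exists_cylinder_approx (m : ProbabilityMeasure (Config d)) {k : ℕ}
    {π : Config d → Fin k} (hπ : Measurable π) {ε : ℝ} (hε : 0 < ε) :
    ∃ π' : Config d → Fin k, Measurable π' ∧
      (∃ r : ℕ, ∀ x y : Config d, (∀ i < r, x i = y i) → π' x = π' y) ∧
      (m : Measure (Config d)).real {x | π x ≠ π' x} ≤ ε := by
  classical
  have happ : ∀ j : Fin k, ∃ C ∈ measurableCylinders fun _ : ℕ => Fin d,
      (m : Measure (Config d)) (symmDiff C (π ⁻¹' {j})) < ENNReal.ofReal (ε / k) := fun j => by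
    have hk : 0 < k := j.pos
    refine exists_measure_symmDiff_lt_of_generateFrom_isSetRing isSetRing_measurableCylinders
      ⟨{Set.univ}, Set.countable_singleton _, ?_, by simp⟩ generateFrom_measurableCylinders.symm
      (hπ (measurableSet_singleton j)) ?_
    · rw [Set.singleton_subset_iff]
      exact univ_mem_measurableCylinders _
    · rw [ENNReal.ofReal_pos]
      positivity
  choose C hC hCm using happ
  have hclop := fun j => clopen_of_mem_measurableCylinders (hC j)
  let c : (Fin k → Prop) → (Config d → Fin k) := fun p x =>
    if h : ∃ j, p j then h.choose else π x
  rcases isEmpty_or_nonempty (Config d) with hemp | ⟨⟨x₀⟩⟩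
  · exact ⟨π, hπ, ⟨0, fun x => hemp.elim x⟩, by simpa using hε.le⟩
  -- The default value is taken at the fixed point `x₀`, so that `π'` depends only on the membership
  -- pattern in the sets `C j`.
  let π' : Config d → Fin k := fun x => c (fun j => x ∈ C j) x₀
  have hr : ∃ r : ℕ, ∀ x y : Config d, (∀ i < r, x i = y i) → π' x = π' y := by
    have h1 : ∀ j, ∃ r : ℕ, ∀ x y : Config d, (∀ i < r, x i = y i) → (x ∈ C j ↔ y ∈ C j) := by
      intro j
      obtain ⟨r, hr⟩ := exists_abs_sub_le_of_agree (clopenIndicator (hclop j)) one_half_pos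
      refine ⟨r, fun x y hxy => ?_⟩
      have := hr x y hxy
      by_cases hx : x ∈ C j <;> by_cases hy : y ∈ C j <;>
        simp [clopenIndicator, hx, hy] at this ⊢ <;> norm_num at this
    choose r hr using h1
    refine ⟨Finset.univ.sup r, fun x y hxy => ?_⟩
    have : (fun j => x ∈ C j) = fun j => y ∈ C j := by
      funext j
      exact propext (hr j x y fun i hi =>
        hxy i (hi.trans_le (Finset.le_sup (f := r) (Finset.mem_univ j))))
    simp only [π', this]
  refine ⟨π', ?_, hr, ?_⟩
  · have h1 : Measurable fun x : Config d => fun j : Fin k => x ∈ C j :=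
      measurable_pi_lambda _ fun j =>
        measurableSet_setOfPred.1 ((hclop j).isOpen.measurableSet)
    exact (measurable_of_finite fun p : Fin k → Prop => c p x₀).comp h1
  · have hsub : {x | π x ≠ π' x} ⊆ ⋃ j : Fin k, symmDiff (C j) (π ⁻¹' {j}) := by
      intro x hx
      rw [Set.mem_iUnion]
      by_cases h : ∃ j, x ∈ C j
      · have h2 : π' x = h.choose := dif_pos h
        refine ⟨h.choose, Or.inl ⟨h.choose_spec, fun h3 => hx ?_⟩⟩
        rw [h2]
        exact h3
      · exact ⟨π x, Or.inr ⟨rfl, fun h3 => h ⟨_, h3⟩⟩⟩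
    have hle : (m : Measure (Config d)) {x | π x ≠ π' x} ≤ ENNReal.ofReal ε := by
      refine (measure_mono hsub).trans ((measure_iUnion_fintype_le _ _).trans ?_)
      refine (Finset.sum_le_sum fun j _ => (hCm j).le).trans ?_
      rw [Finset.sum_const, Finset.card_univ, Fintype.card_fin, ← ENNReal.ofReal_nsmul]
      refine ENNReal.ofReal_le_ofReal ?_
      rw [nsmul_eq_mul]
      rcases Nat.eq_zero_or_pos k with rfl | hk
      · simpa using hε.le
      · have : (k : ℝ) ≠ 0 := by exact_mod_cast hk.ne'
        rw [mul_div_cancel₀ _ this]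
    exact ENNReal.toReal_le_of_le_ofReal hε.le hle

/-- The transition matrix `(1 - δ) 1_{a = c} + δ / k`. -/
noncomputable def smoothKernel (k : ℕ) (δ : ℝ) (a c : Fin k) : ℝ :=
  (1 - δ) * (if a = c then 1 else 0) + δ / k

theorem smoothKernel_pos {k : ℕ} {δ : ℝ} (h0 : 0 < δ) (h1 : δ < 1) (a c : Fin k) :
    0 < smoothKernel k δ a c := by
  have hk : (0 : ℝ) < k := by exact_mod_cast a.pos
  have : 0 < δ / k := by positivity
  unfold smoothKernel
  split_ifs <;> linarith

theorem sum_smoothKernel {k : ℕ} (δ : ℝ) (c : Fin k) : ∑ a, smoothKernel k δ a c = 1 := by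
  have hk : (k : ℝ) ≠ 0 := by exact_mod_cast c.pos.ne'
  simp only [smoothKernel, Finset.sum_add_distrib, ← Finset.mul_sum, Finset.sum_ite_eq',
    Finset.mem_univ, if_true, Finset.sum_const, Finset.card_univ, Fintype.card_fin, nsmul_eq_mul]
  rw [mul_div_cancel₀ _ hk]
  ring

theorem neg_log_smoothKernel_le {k : ℕ} {δ : ℝ} (h0 : 0 < δ) (h1 : δ < 1) (a c : Fin k) :
    -Real.log (smoothKernel k δ a c) ≤
      -Real.log (1 - δ) + if a ≠ c then Real.log (k / δ) else 0 := by
  have hk : (0 : ℝ) < k := by exact_mod_cast a.pos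
  have hd : 0 < δ / k := by positivity
  by_cases h : a = c
  · have := Real.log_le_log (show (0 : ℝ) < 1 - δ by linarith)
      (show 1 - δ ≤ smoothKernel k δ a c by simp [smoothKernel, h]; positivity)
    simpa [h] using this
  · have h2 : Real.log (1 - δ) ≤ 0 := Real.log_nonpos (by linarith) (by linarith)
    have h3 : Real.log (k / δ) = -Real.log (δ / k) := by rw [← Real.log_inv, inv_div]
    simp only [smoothKernel, h, if_false, mul_zero, zero_add, ne_eq, not_false_eq_true, if_true]
    linarith

/-- Arbitrary finite measurable partitions are treated directly. The total excess `η` is shared by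
the variation of `g`, the channel cost `-log(1 - δ)` where `π = π'`, and the large cost `A` on the
small set where they differ. Thus `δ` is fixed first and the approximation, depending on `A`,
afterwards. -/
theorem entropy_le_neg_integral [NeZero d] {g : C(Config d, ℝ)} (hg : ruelle g 1 = 1)
    {m : ProbabilityMeasure (Config d)} (hm : m ∈ invariantMeasures d) :
    entropy shift (m : Measure (Config d)) ≤
      ((-∫ x, g x ∂(m : Measure (Config d)) : ℝ) : EReal) := by
  refine iSup_le fun k => iSup₂_le fun π hπ => ereal_le_of_forall_pos_le_add fun η hη => ?_
  obtain ⟨δ, hδ0, hδ1, hδ⟩ : ∃ δ : ℝ, 0 < δ ∧ δ < 1 ∧ -Real.log (1 - δ) ≤ η / 3 := by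
    refine ⟨1 - Real.exp (-(η / 3)), ?_, ?_, ?_⟩
    · have : Real.exp (-(η / 3)) < 1 := by rw [Real.exp_lt_one_iff]; linarith
      linarith
    · linarith [Real.exp_pos (-(η / 3))]
    · rw [sub_sub_cancel, Real.log_exp, neg_neg]
  set A : ℝ := |Real.log (k / δ)| + 1
  have hA : 0 < A := by positivity
  obtain ⟨π', hπ', ⟨r, hr⟩, happ⟩ := exists_cylinder_approx m hπ (show 0 < η / 3 / A by positivity)
  obtain ⟨K, hK⟩ := exists_joinEntropy_le hg hm hπ hπ' hr (smoothKernel_pos hδ0 hδ1)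
    (sum_smoothKernel δ) (show 0 < η / 3 by positivity)
  refine limsup_div_le (K := K) fun n => (hK n).trans ?_
  have hS : MeasurableSet {x | π x ≠ π' x} := (measurableSet_eq_fun hπ hπ').compl
  have hE : ∫ x, -Real.log (smoothKernel k δ (π x) (π' x)) ∂(m : Measure (Config d)) ≤
      η / 3 + η / 3 := by
    have hi := (integral_comp_fintype (m : Measure (Config d)) (hπ.prodMk hπ')
      fun a : Fin k × Fin k => -Real.log (smoothKernel k δ a.1 a.2)).1
    have hi2 : Integrable ({x | π x ≠ π' x}.indicator fun _ => A) (m : Measure (Config d)) :=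
      (integrable_const A).indicator hS
    have h1 : ∫ x, -Real.log (smoothKernel k δ (π x) (π' x)) ∂(m : Measure (Config d)) ≤
        ∫ x, (η / 3 + {x | π x ≠ π' x}.indicator (fun _ => A) x) ∂(m : Measure (Config d)) := by
      refine integral_mono hi ((integrable_const _).add hi2) fun x => ?_
      refine (neg_log_smoothKernel_le hδ0 hδ1 _ _).trans (add_le_add hδ ?_)
      by_cases hx : π x = π' x
      · simp [hx]
      · simp only [hx, ne_eq, not_false_eq_true, if_true, Set.indicator, Set.mem_ofPred_eq]
        linarith [le_abs_self (Real.log (k / δ))]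
    refine h1.trans ?_
    rw [integral_add (integrable_const _) hi2, integral_indicator_const _ hS]
    simp only [integral_const, probReal_univ, smul_eq_mul]
    have h2 := mul_le_mul_of_nonneg_right happ hA.le
    rw [div_mul_cancel₀ _ hA.ne'] at h2
    linarith
  have hn : (0 : ℝ) ≤ n := Nat.cast_nonneg n
  have := mul_le_mul_of_nonneg_left (show -(∫ x, g x ∂(m : Measure (Config d))) + η / 3 +
    ∫ x, -Real.log (smoothKernel k δ (π x) (π' x)) ∂(m : Measure (Config d)) ≤
      -(∫ x, g x ∂(m : Measure (Config d))) + η by linarith) hn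
  linarith

/-- The partition by the zeroth symbol suffices. Invariance under `L_g^*` gives `μ[w] = ∫ exp(S_n
g(wy)) dμ(y)`, so `-log μ[w]` equals `-S_n g` on the cylinder up to `nε + K`. -/
theorem neg_integral_le_entropy [NeZero d] {g : C(Config d, ℝ)}
    {μ : ProbabilityMeasure (Config d)} (hμ : μ ∈ invariantMeasures d)
    (he : ∀ ψ : C(Config d, ℝ),
      ∫ x, ruelle g ψ x ∂(μ : Measure (Config d)) = ∫ x, ψ x ∂(μ : Measure (Config d))) :
    ((-∫ x, g x ∂(μ : Measure (Config d)) : ℝ) : EReal) ≤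
      entropy shift (μ : Measure (Config d)) := by
  have he' : ruelleDual g (μ : Measure (Config d)) =
      ENNReal.ofReal 1 • (μ : Measure (Config d)) :=
    ruelleDual_eq_smul zero_le_one fun ψ => by rw [he, one_mul]
  let π : Config d → Fin d := fun x => x 0
  have hπ : Measurable π := measurable_pi_apply 0
  have hs : Measurable (shift : Config d → Config d) := continuous_shift.measurable
  have hname : ∀ n x, orbitName shift π n x = fun i : Fin n => x i := fun n x => by
    funext i
    simp [orbitName, π, shift_iterate]
  refine le_trans ?_ (le_iSup_of_le d (le_iSup₂_of_le π hπ le_rfl))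
  -- The gap between `-∫ g dμ` and `z` serves as the variation rate `ε`.
  refine EReal.ge_of_forall_gt_iff_ge.1 fun z hz => ?_
  have hε := sub_pos.2 (EReal.coe_lt_coe_iff.1 hz)
  obtain ⟨K, hK0, hK⟩ := exists_birkhoffSum_variation_le g hε
  refine le_limsup_div (K := K) fun n => ?_
  have hW := measurable_orbitName hs hπ n
  have hcl : ∀ w, IsClopen (orbitName shift π n ⁻¹' {w}) := fun w => by
    refine (isClopen_discrete {w}).preimage (continuous_pi fun i => ?_)
    exact (continuous_apply 0).comp (continuous_shift.iterate _)
  have hp : ∀ w, (μ : Measure (Config d)).real (orbitName shift π n ⁻¹' {w}) =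
      ∫ y, Real.exp (birkhoffSum shift g n (prepend w y)) ∂(μ : Measure (Config d)) := by
    intro w
    have h1 := integral_ruelle_pow_of_eigen one_pos he' n (clopenIndicator (hcl w))
    rw [one_pow, one_mul, integral_clopenIndicator] at h1
    rw [← h1]
    refine integral_congr_ae (Eventually.of_forall fun y => ?_)
    have hu : ∀ u : Fin n → Fin d, clopenIndicator (hcl w) (prepend u y) =
        if u = w then 1 else 0 := fun u => by
      have : orbitName shift π n (prepend u y) = u := by
        rw [hname]
        funext i
        rw [prepend_lt _ _ i.2]
      simp only [clopenIndicator, ContinuousMap.coe_mk, Set.indicator, Set.mem_preimage, this,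
        Set.mem_singleton_iff]
    simp only [ruelle_pow_apply, hu, mul_ite, mul_one, mul_zero, Finset.sum_ite_eq',
      Finset.mem_univ, if_true]
  set B : ℝ := n * (-(∫ x, g x ∂(μ : Measure (Config d))) - z) + K
  have hbd : ∀ x, -birkhoffSum shift g n x - B ≤
      -Real.log ((μ : Measure (Config d)).real
        (orbitName shift π n ⁻¹' {orbitName shift π n x})) := by
    intro x
    have hv : ∀ y, |birkhoffSum shift g n x -
        birkhoffSum shift g n (prepend (orbitName shift π n x) y)| ≤ B := fun y => by
      rw [hname]
      exact hK n x _ (agree_prepend_coords x y)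
    have hi : Integrable (fun y => Real.exp (birkhoffSum shift g n
        (prepend (orbitName shift π n x) y))) (μ : Measure (Config d)) :=
      integrable_continuousMap ⟨_, Real.continuous_exp.comp
        ((continuous_birkhoffSum g n).comp (continuous_prepend _))⟩ _
    have h1 := integral_mono (integrable_const (Real.exp (birkhoffSum shift g n x - B))) hi
      fun y => Real.exp_le_exp.2 (by linarith [(abs_le.1 (hv y)).2])
    have h2 := integral_mono hi (integrable_const (Real.exp (birkhoffSum shift g n x + B)))
      fun y => Real.exp_le_exp.2 (by linarith [(abs_le.1 (hv y)).1])
    simp only [integral_const, probReal_univ, one_smul] at h1 h2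
    rw [← hp] at h1 h2
    have h3 := Real.log_le_log ((Real.exp_pos _).trans_le h1) h2
    rw [Real.log_exp] at h3
    linarith
  obtain ⟨hi1, hi2⟩ := integral_birkhoffSum hμ g.continuous.measurable
    (integrable_continuousMap g _) n
  obtain ⟨hj1, hj2⟩ := integral_comp_fintype (μ : Measure (Config d)) hW fun w =>
    -Real.log ((μ : Measure (Config d)).real (orbitName shift π n ⁻¹' {w}))
  have hn : Integrable (fun x => -birkhoffSum shift g n x) (μ : Measure (Config d)) := hi1.neg
  have h1 := integral_mono (hn.sub (integrable_const B)) hj1 hbd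
  have h2 : ∫ x, (-birkhoffSum shift g n x - B) ∂(μ : Measure (Config d)) = n * z - K := by
    rw [integral_sub hn (integrable_const B), integral_neg, hi2]
    simp only [integral_const, probReal_univ, one_smul, B]
    ring
  rw [joinEntropy_eq]
  simp only [Real.negMulLog, neg_mul]
  simp only [mul_neg] at hj2
  rw [← hj2, ← h2]
  exact h1

/-- A state maximizing the free energy of a normalized potential is fixed by the dual operator. -/
theorem integral_ruelle_eq_of_le_entropy [NeZero d] {g : C(Config d, ℝ)} (hg : ruelle g 1 = 1)
    {m : ProbabilityMeasure (Config d)} (hm : m ∈ invariantMeasures d)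
    (hle : ((-∫ x, g x ∂(m : Measure (Config d)) : ℝ) : EReal) ≤
      entropy shift (m : Measure (Config d))) (ψ : C(Config d, ℝ)) :
    ∫ x, ruelle g ψ x ∂(m : Measure (Config d)) = ∫ x, ψ x ∂(m : Measure (Config d)) := by
  have hexp : ∀ χ : C(Config d, ℝ), Continuous fun x => Real.exp (χ x) := fun χ =>
    Real.continuous_exp.comp χ.continuous
  -- With `Λ = log L_g e^χ`, the potential `g + χ - Λ ∘ σ` is again normalized, so the entropy bound
  -- holds for it. Combined with `hle` and invariance this gives `∫ χ dm ≤ ∫ Λ dm`, and `Λ` is `L_g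
  -- χ` up to a quadratic error.
  have hpert : ∀ χ : C(Config d, ℝ), ‖χ‖ ≤ 1 → ∫ x, χ x ∂(m : Measure (Config d)) ≤
      (∫ x, ruelle g χ x ∂(m : Measure (Config d))) + ‖χ‖ ^ 2 := by
    intro χ hχ
    let E : C(Config d, ℝ) := ⟨fun x => Real.exp (χ x), hexp χ⟩
    have hEpos : ∀ x, 0 < ruelle g E x := fun x => by
      rw [ruelle_apply]
      exact Finset.sum_pos (fun a _ => mul_pos (Real.exp_pos _) (Real.exp_pos _))
        ⟨0, Finset.mem_univ _⟩
    let Λ := logPos (ruelle g E) hEpos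
    let σ : C(Config d, Config d) := ⟨shift, continuous_shift⟩
    have hg' : ruelle (g + χ - Λ.comp σ) 1 = 1 := by
      ext x
      have h1 : ∀ a, Real.exp ((g + χ - Λ.comp σ) (cons a x)) =
          Real.exp (g (cons a x)) * E (cons a x) / ruelle g E x := fun a => by
        simp only [ContinuousMap.sub_apply, ContinuousMap.add_apply, ContinuousMap.comp_apply, σ,
          ContinuousMap.coe_mk, shift_cons, Λ, logPos, E]
        rw [Real.exp_sub, Real.exp_add, Real.exp_log (hEpos x)]
      rw [ruelle_apply]
      simp only [h1, ContinuousMap.one_apply, mul_one]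
      rw [← Finset.sum_div, ← ruelle_apply, div_self (hEpos x).ne']
    have h2 := hle.trans (entropy_le_neg_integral hg' hm)
    rw [EReal.coe_le_coe_iff] at h2
    have h3 : ∫ x, (g + χ - Λ.comp σ) x ∂(m : Measure (Config d)) =
        ∫ x, g x ∂(m : Measure (Config d)) + ∫ x, χ x ∂(m : Measure (Config d)) -
          ∫ x, Λ x ∂(m : Measure (Config d)) := by
      have e1 := integral_sub (integrable_continuousMap (g + χ) (m : Measure (Config d)))
        (integrable_continuousMap (Λ.comp σ) _)
      have e2 := integral_add (integrable_continuousMap g (m : Measure (Config d)))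
        (integrable_continuousMap χ _)
      rw [← mem_invariantMeasures_iff.1 hm Λ, ← e2]
      exact e1
    have h4 : ∀ x, Λ x ≤ ruelle g χ x + ‖χ‖ ^ 2 := fun x => by
      have h5 : Λ x ≤ ruelle g E x - 1 := Real.log_le_sub_one_of_pos (hEpos x)
      have h6 : ruelle g E x ≤ ∑ a, Real.exp (g (cons a x)) * (1 + χ (cons a x) + ‖χ‖ ^ 2) := by
        rw [ruelle_apply]
        refine Finset.sum_le_sum fun a _ => mul_le_mul_of_nonneg_left ?_ (Real.exp_pos _).le
        have h7 := χ.norm_coe_le_norm (cons a x)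
        have h8 := (abs_le.1 (Real.abs_exp_sub_one_sub_id_le (h7.trans hχ))).2
        have h9 : χ (cons a x) ^ 2 ≤ ‖χ‖ ^ 2 := sq_le_sq' (by linarith [(abs_le.1 h7).1])
          (abs_le.1 h7).2
        change Real.exp (χ (cons a x)) ≤ _
        linarith
      have h10 : ∑ a : Fin d, Real.exp (g (cons a x)) = 1 := by
        have := congrArg (fun θ : C(Config d, ℝ) => θ x) hg
        simpa [ruelle_apply] using this
      have h11 : ∑ a, Real.exp (g (cons a x)) * (1 + χ (cons a x) + ‖χ‖ ^ 2) =
          1 + ruelle g χ x + ‖χ‖ ^ 2 := by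
        simp only [mul_add, mul_one, Finset.sum_add_distrib, ← Finset.sum_mul, h10, one_mul,
          ruelle_apply]
      linarith
    have h5 := integral_mono (integrable_continuousMap Λ (m : Measure (Config d)))
      ((integrable_continuousMap (ruelle g χ) _).add (integrable_const (‖χ‖ ^ 2))) h4
    have h6 : ∫ x, (ruelle g χ x + ‖χ‖ ^ 2) ∂(m : Measure (Config d)) =
        ∫ x, ruelle g χ x ∂(m : Measure (Config d)) + ‖χ‖ ^ 2 := by
      rw [integral_add (integrable_continuousMap (ruelle g χ) _) (integrable_const _)]
      simp
    simp only [Pi.add_apply] at h5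
    rw [h6] at h5
    linarith
  -- Applying `hpert` to `t χ` and dividing by `t` makes the quadratic error at most `ε`. The
  -- inequality is linear in `χ`, so using it for `-ψ` as well gives equality.
  have hdir : ∀ χ : C(Config d, ℝ), ∫ x, χ x ∂(m : Measure (Config d)) ≤
      ∫ x, ruelle g χ x ∂(m : Measure (Config d)) := by
    intro χ
    refine le_of_forall_pos_le_add fun ε hε => ?_
    set N := ‖χ‖ + 1
    have hN : 0 < N := by positivity
    obtain ⟨t, ht0, ht1, ht2⟩ : ∃ t : ℝ, 0 < t ∧ t * N ≤ 1 ∧ t * N ^ 2 ≤ ε := by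
      refine ⟨min (1 / N) (ε / N ^ 2), by positivity, ?_, ?_⟩
      · rw [← le_div_iff₀ hN]; exact min_le_left _ _
      · rw [← le_div_iff₀ (by positivity)]; exact min_le_right _ _
    have hnorm : ‖t • χ‖ ≤ t * N := by
      rw [norm_smul, Real.norm_of_nonneg ht0.le]
      exact mul_le_mul_of_nonneg_left (by simp [N]) ht0.le
    have h1 := hpert (t • χ) (hnorm.trans ht1)
    simp only [map_smul, ContinuousMap.smul_apply, smul_eq_mul] at h1
    rw [integral_const_mul, integral_const_mul] at h1
    have h2 : ‖t • χ‖ ^ 2 ≤ t * ε := by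
      refine (pow_le_pow_left₀ (norm_nonneg _) hnorm 2).trans ?_
      rw [mul_pow, sq t, mul_assoc]
      exact mul_le_mul_of_nonneg_left ht2 ht0.le
    refine le_of_mul_le_mul_left ?_ ht0
    linarith
  refine le_antisymm ?_ (hdir ψ)
  have := hdir (-ψ)
  simp only [map_neg, ContinuousMap.neg_apply, integral_neg] at this
  linarith

/-! ### Equilibrium states and the main theorem -/

theorem IsAsymptoticState.eq_of_integral_ruelle [NeZero d] {g : C(Config d, ℝ)}
    {μ m : ProbabilityMeasure (Config d)} (h : IsAsymptoticState g μ) (hg : ruelle g 1 = 1)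
    (hm : ∀ ψ : C(Config d, ℝ),
      ∫ x, ruelle g ψ x ∂(m : Measure (Config d)) = ∫ x, ψ x ∂(m : Measure (Config d))) :
    m = μ := by
  have hdual : ∀ P : ProbabilityMeasure (Config d), (∀ ψ : C(Config d, ℝ),
      ∫ x, ruelle g ψ x ∂(P : Measure (Config d)) = ∫ x, ψ x ∂(P : Measure (Config d))) →
      ruelleDual g (P : Measure (Config d)) = ENNReal.ofReal 1 • (P : Measure (Config d)) :=
    fun P hP => ruelleDual_eq_smul zero_le_one fun ψ => by rw [hP, one_mul]
  have hmem : m ∈ dualGibbs g := ⟨1, one_pos, hdual m hm⟩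
  rwa [h.dualGibbs_eq one_pos (hdual μ (h.integral_ruelle_of_normalized hg))] at hmem

theorem entropy_add_le_iff {h : EReal} {a b : ℝ} : h + (b : EReal) ≤ (a : EReal) ↔
    h ≤ ((a - b : ℝ) : EReal) := by
  rw [EReal.coe_sub, EReal.le_sub_iff_add_le (Or.inl (EReal.coe_ne_bot _))
    (Or.inl (EReal.coe_ne_top _))]

theorem le_entropy_add_iff {h : EReal} {a b : ℝ} : (a : EReal) ≤ h + (b : EReal) ↔
    ((a - b : ℝ) : EReal) ≤ h := by
  rw [EReal.coe_sub, EReal.sub_le_iff_le_add (Or.inl (EReal.coe_ne_bot _))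
    (Or.inl (EReal.coe_ne_top _))]

/-- The constant `c` allows the same argument to serve the normalized potential (`c = 0`) and the
original one (`c = log l`): in both cases the pressure is `c`, and equality of the free energy with
`c` is equality in the entropy bound for `g`. -/
theorem IsAsymptoticState.equilibriumStates_eq [NeZero d] {g : C(Config d, ℝ)}
    {μ : ProbabilityMeasure (Config d)} (h : IsAsymptoticState g μ) (hg : ruelle g 1 = 1)
    {f : C(Config d, ℝ)} {c : ℝ} (hf : ∀ m ∈ invariantMeasures d,
      ∫ x, f x ∂(m : Measure (Config d)) = ∫ x, g x ∂(m : Measure (Config d)) + c) :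
    equilibriumStates f = {μ} := by
  have hinv := h.mem_invariantMeasures hg
  have hup : ∀ m ∈ invariantMeasures d, freeEnergy f m ≤ (c : EReal) := fun m hm => by
    rw [freeEnergy, entropy_add_le_iff, hf m hm, sub_add_cancel_right]
    exact entropy_le_neg_integral hg hm
  have hlo : (c : EReal) ≤ freeEnergy f μ := by
    rw [freeEnergy, le_entropy_add_iff, hf μ hinv, sub_add_cancel_right]
    exact neg_integral_le_entropy hinv (h.integral_ruelle_of_normalized hg)
  have hP : pressure f = (c : EReal) :=
    le_antisymm (iSup₂_le hup) (hlo.trans (le_iSup₂_of_le μ hinv le_rfl))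
  ext m
  rw [equilibriumStates, hP]
  constructor
  · rintro ⟨hm, he⟩
    have h1 := he.ge
    rw [freeEnergy, le_entropy_add_iff, hf m hm, sub_add_cancel_right] at h1
    exact h.eq_of_integral_ruelle hg (integral_ruelle_eq_of_le_entropy hg hm h1)
  · rintro rfl
    exact ⟨hinv, le_antisymm (hup _ hinv) hlo⟩

theorem IsNormalization.integral_eq {f φ g : C(Config d, ℝ)} {l : ℝ}
    (h : IsNormalization f φ l g) {m : ProbabilityMeasure (Config d)}
    (hm : m ∈ invariantMeasures d) :
    ∫ x, f x ∂(m : Measure (Config d)) =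
      ∫ x, g x ∂(m : Measure (Config d)) + Real.log l := by
  let Λ := logPos φ h.eigenfunction_pos
  let Λσ := Λ.comp ⟨shift, continuous_shift⟩
  have h1 : ∀ x, f x = (g + Λσ - Λ) x + Real.log l := fun x => by
    simp only [ContinuousMap.sub_apply, ContinuousMap.add_apply, h.eq, Λσ, Λ, logPos,
      ContinuousMap.comp_apply, ContinuousMap.coe_mk]
    ring
  have e1 := integral_sub (integrable_continuousMap (g + Λσ) (m : Measure (Config d)))
    (integrable_continuousMap Λ _)
  have e2 := integral_add (integrable_continuousMap g (m : Measure (Config d)))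
    (integrable_continuousMap Λσ _)
  have e3 := mem_invariantMeasures_iff.1 hm Λ
  have e4 : ∫ x, (g + Λσ - Λ) x ∂(m : Measure (Config d)) =
      ∫ x, g x ∂(m : Measure (Config d)) := by
    refine e1.trans ?_
    rw [show ∫ x, (g + Λσ) x ∂(m : Measure (Config d)) = _ from e2, ← e3]
    exact add_sub_cancel_right _ _
  simp only [h1]
  rw [integral_add (integrable_continuousMap _ _) (integrable_const _), e4]
  simp

/-- The finite-volume conclusions for a potential with an asymptotic state. -/
theorem IsAsymptoticState.gibbs_sets_eq [NeZero d] {f : C(Config d, ℝ)}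
    {ν : ProbabilityMeasure (Config d)} (h : IsAsymptoticState f ν) {lam : ℝ} (hl : 0 < lam)
    (hν : ruelleDual f (ν : Measure (Config d)) = ENNReal.ofReal lam • (ν : Measure (Config d))) :
    thermodynamicLimits (potentialEnergy f) = {ν} ∧
      dlrMeasures (potentialEnergy f) = {ν} ∧
      ∀ w : Config d,
        (∀ (n : ℕ) (x : Config d),
          Tendsto (fun N : ℕ => interactionPartialEnergy (potentialInteraction f w) n N x)
            atTop (𝓝 (interactionEnergy (potentialInteraction f w) n x))) ∧
        thermodynamicLimits (interactionEnergy (potentialInteraction f w)) = {ν} ∧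
        dlrMeasures (interactionEnergy (potentialInteraction f w)) = {ν} := by
  have h1 := h.thermodynamicLimits_eq
  have h2 := h.dlrMeasures_eq hl hν
  refine ⟨h1, h2, fun w => ⟨fun n x => ?_, ?_, ?_⟩⟩
  · rw [interactionEnergy_eq]
    exact tendsto_interactionPartialEnergy f w x n
  · rw [thermodynamicLimits_congr (kernelMeasure_interactionEnergy f w), h1]
  · rw [dlrMeasures_congr (kernelMeasure_interactionEnergy f w), h2]

end WaltersGibbs

theorem mainTheorem3 (d : ℕ) [NeZero d] (f : C(Config d, ℝ)) (hf : IsWalters f) :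
    -- the normalization exists and does not depend on the choice of the eigenfunction
    (∃! fbar : C(Config d, ℝ), ∃ (φ : C(Config d, ℝ)) (lam : ℝ), IsNormalization f φ lam fbar) ∧
    ∀ (φ : C(Config d, ℝ)) (lam : ℝ) (fbar : C(Config d, ℝ)), IsNormalization f φ lam fbar →
      -- `lam` is the principal eigenvalue
      spectralRadius ℝ (ruelle f) = ENNReal.ofReal lam ∧
      ∃ μ ν : ProbabilityMeasure (Config d),
        -- part 1
        (equilibriumStates f = {μ} ∧ equilibriumStates fbar = {μ} ∧
          ∀ y : Config d,
            (∀ n : ℕ, (gibbs (potentialEnergy fbar) n y : Measure (Config d)) =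
              (ruelleDual fbar)^[n] (Measure.dirac (shift^[n] y))) ∧
            Tendsto (fun n : ℕ => gibbs (potentialEnergy fbar) n y) atTop (𝓝 μ)) ∧
        -- part 2
        (ruelleDual f (ν : Measure (Config d)) =
            ENNReal.ofReal lam • (ν : Measure (Config d)) ∧
          dualGibbs f = {ν} ∧
          ∀ y : Config d,
            (∀ n : ℕ, (gibbs (potentialEnergy f) n y : Measure (Config d)) =
              (ENNReal.ofReal ((ruelle f ^ n) 1 (shift^[n] y)))⁻¹ •
                (ruelleDual f)^[n] (Measure.dirac (shift^[n] y))) ∧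
            Tendsto (fun n : ℕ => gibbs (potentialEnergy f) n y) atTop (𝓝 ν)) ∧
        -- part 3, for `f` and for `fbar`
        (thermodynamicLimits (potentialEnergy f) = {ν} ∧
          dlrMeasures (potentialEnergy f) = {ν} ∧
          ∀ w : Config d,
            (∀ (n : ℕ) (x : Config d),
              Tendsto (fun N : ℕ => interactionPartialEnergy (potentialInteraction f w) n N x)
                atTop (𝓝 (interactionEnergy (potentialInteraction f w) n x))) ∧
            thermodynamicLimits (interactionEnergy (potentialInteraction f w)) = {ν} ∧
            dlrMeasures (interactionEnergy (potentialInteraction f w)) = {ν}) ∧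
        (dualGibbs fbar = {μ} ∧
          thermodynamicLimits (potentialEnergy fbar) = {μ} ∧
          dlrMeasures (potentialEnergy fbar) = {μ} ∧
          ∀ w : Config d,
            (∀ (n : ℕ) (x : Config d),
              Tendsto (fun N : ℕ => interactionPartialEnergy (potentialInteraction fbar w) n N x)
                atTop (𝓝 (interactionEnergy (potentialInteraction fbar w) n x))) ∧
            thermodynamicLimits (interactionEnergy (potentialInteraction fbar w)) = {μ} ∧
            dlrMeasures (interactionEnergy (potentialInteraction fbar w)) = {μ}) := by
  have hd := hf.uniformDistortion
  refine ⟨?_, fun φ lam fbar h => ⟨h.spectralRadius_eq, ?_⟩⟩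
  · obtain ⟨g, φ, l, h⟩ := exists_isNormalization hd
    refine ⟨g, ⟨φ, l, h⟩, ?_⟩
    rintro g' ⟨φ', l', h'⟩
    exact h.unique hd h'
  · have hone := h.ruelle_one
    obtain ⟨μ, hμ⟩ := exists_asymptoticState_of_normalized hone (h.uniformDistortion hd)
    obtain ⟨ν, hν, hνe⟩ := h.exists_eigenmeasure hμ
    have hμe : ruelleDual fbar (μ : Measure (Config d)) =
        ENNReal.ofReal 1 • (μ : Measure (Config d)) :=
      ruelleDual_eq_smul zero_le_one fun ψ => by
        rw [hμ.integral_ruelle_of_normalized hone, one_mul]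
    refine ⟨μ, ν, ⟨?_, ?_, fun y => ⟨fun n => ?_, ?_⟩⟩, ⟨hνe, ?_, fun y => ⟨fun n => ?_, ?_⟩⟩,
      hν.gibbs_sets_eq h.eigenvalue_pos hνe, ?_, hμ.gibbs_sets_eq one_pos hμe⟩
    · exact hμ.equilibriumStates_eq hone fun m hm => h.integral_eq hm
    · exact hμ.equilibriumStates_eq hone (c := 0) fun m _ => (add_zero _).symm
    · refine (kernelMeasure_potentialEnergy fbar n y).trans ?_
      rw [ruelle_pow_one_of_normalized hone]
      simp
    · exact hμ.tendsto_gibbs tendsto_id fun _ => y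
    · exact hν.dualGibbs_eq h.eigenvalue_pos hνe
    · exact kernelMeasure_potentialEnergy f n y
    · exact hν.tendsto_gibbs tendsto_id fun _ => y
    · exact hμ.dualGibbs_eq one_pos hμe
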